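/- **Model.** A DC microgrid has an undirected connected graph on $n=n_s+n_l$ nodes, split into $n_s\ge1$ sources and $n_l\ge1$ loads. Each line $k$ has a resistance $r_k>0$; $B=\mathrm{col}(B_s,B_l)$ is an oriented incidence matrix, $\Gamma=\mathrm{diag}(r_k^{-1})$, and $$B\Gamma B^T=\begin{bmatrix}Y_{ss}&Y_{sl}\\Y_{ls}&Y_{ll}\end{bmatrix}.$$ The sources communicate over an undirected, unweighted, connected graph with Laplacian $L_c$. Let $C_s=\mathrm{diag}(C_1,\dots,C_{n_s})$ with $C_i>0$, and let $I_l^*,P_l^*\in\mathbb R^{n_l}_{\le0}$ and $Y_l^*\ge0$ diagonal be the constant-current, constant-power and constant-impedance parts of the loads. Write $[v]$ for the diagonal matrix with diagonal $v$ and $V=\mathrm{col}(V_s,V_l)$. Put $$P_s(V)=[V_s](Y_{ss}V_s+Y_{sl}V_l),\qquad I_l(V_l)=I_l^*-Y_l^*V_l+[V_l]^{-1}P_l^* .$$ The closed-loop system is the differential-algebraic system $$C_s\dot V_s=-[V_s]L_cC_s^{-1}P_s(V),\qquad I_l(V_l)=Y_{ls}V_s+Y_{ll}V_l. \tag{1}$$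 A solution of (1) on an interval is a continuous function $V$ with $V_s$ differentiable that satisfies (1) there. **Equilibria.** Let $\mathcal I_{ZIP}(V)=I_l(V_l)-Y_{ll}V_l-Y_{ls}V_s$, $Y_{red}=Y_{ss}-Y_{sl}Y_{ll}^{-1}Y_{ls}$ and $$\mathcal P_{ZIP}(V)=[V_s]Y_{red}V_s+[V_s]Y_{sl}Y_{ll}^{-1}I_l(V_l)+C_s\mathbb 1\,\frac{\mathbb 1^TI_l(V_l)}{\mathbb 1^T[V_s]^{-1}C_s\mathbb 1},$$ and let $\mathcal E_{ZIP}=\{V\in\mathbb R^n_{>0}:\ \mathcal I_{ZIP}(V)=0,\ \mathcal P_{ZIP}(V)=0\}$ be the set of equilibria of (1). **Bregman function.** For $\overline V\in\mathcal E_{ZIP}$ let $\overline P_s=P_s(\overline V)$ and, for $V\in\mathbb R^n_{>0}$, $$M(V)=\tfrac12V^T\Big(B\Gamma B^T+\begin{bmatrix}0&0\\0&Y_l^*\end{bmatrix}\Big)V-\sum_{i}\overline P_{s,i}\ln V_{s,i}-\sum_{i}P^*_{l,i}\ln V_{l,i},$$ $$\mathcal M(V)=M(V)-M(\overline V)-\nabla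 M(\overline V)^T(V-\overline V).$$ The sublevel set of $\mathcal M$ around $\overline V$ at level $c$ is the connected component containing $\overline V$ of $\{V\in\mathbb R^n_{>0}:\mathcal M(V)\le c\}$. **Theorem.** Assume that $\overline V\in\mathcal E_{ZIP}$ satisfies $$Y_{ll}+Y_l^*+[\overline V_l]^{-2}[P_l^*]-Y_{ls}\big(Y_{ss}+[\overline V_s]^{-2}[\overline P_s]\big)^{-1}Y_{sl}>0$$ (positive definite). Then there is a level $c>0$ such that the sublevel set $\Lambda_{ZIP}$ of $\mathcal M$ around $\overline V$ at level $c$ is a compact subset of $\mathbb R^n_{>0}$ and a neighbourhood of $\overline V$, and the following hold. 1. For each $V_0\in\Lambda_{ZIP}$ with $\mathcal I_{ZIP}(V_0)=0$ there is a solution of (1) on $[0,\infty)$ with $V(0)=V_0$; and each solution of (1) on an interval $[0,T)$, $0<T<\infty$, with $V(0)\in\Lambda_{ZIP}$ extends to a solution on $[0,\infty)$. 2. For each solution $V$ of (1) on $[0,\infty)$ with $V(0)\in\Lambda_{ZIP}$ and all $t\ge0$: $V(t)\in\Lambda_{ZIP}$, all entries of $V(t)$ are positive, and $\prod_{i=1}^{n_s}V_i(t)^{C_i}=\prod_{i=1}^{n_s}V_i(0)^{C_i}$.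 3. For each such $V$, the distance of $V(t)$ to the set $\mathcal E_{ZIP}\cap\Lambda_{ZIP}\cap\mathcal V_{ZIP}$ tends to $0$ as $t\to\infty$ (in particular this set is non-empty), where $$\mathcal V_{ZIP}=\Big\{V\in\Lambda_{ZIP}:\ \mathcal I_{ZIP}(V)=0,\ \prod_{i=1}^{n_s}V_i^{C_i}=\prod_{i=1}^{n_s}V_i(0)^{C_i}\Big\}.$$ -/

import Mathlib

open Set Filter Topology Matrix

/-- Data of a resistive DC microgrid with sources `S`, ZIP loads `L` and a communication network
among the sources. -/
structure Microgrid (S L : Type*) where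
  /-- The electrical network: an undirected connected graph on sources and loads. -/
  grid : SimpleGraph (S ⊕ L)
  grid_connected : grid.Connected
  /-- An (arbitrary) orientation of the lines, used to write the incidence matrix. -/
  tail : grid.edgeSet → S ⊕ L
  head : grid.edgeSet → S ⊕ L
  edge_eq : ∀ e : grid.edgeSet, e.val = s(tail e, head e)
  /-- Line resistances. -/
  r : grid.edgeSet → ℝ
  r_pos : ∀ e, 0 < r e
  /-- The communication network: an undirected connected graph on the sources. -/
  comm : SimpleGraph S
  comm_connected : comm.Connected
  /-- Controller parameters. -/
  C : S → ℝ
  C_pos : ∀ i, 0 < C i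
  /-- Constant current part of the loads. -/
  Istar : L → ℝ
  Istar_nonpos : ∀ i, Istar i ≤ 0
  /-- Load conductances (diagonal entries of the matrix of constant impedance loads). -/
  Ystar : L → ℝ
  Ystar_nonneg : ∀ i, 0 ≤ Ystar i
  /-- Constant power part of the loads. -/
  Pstar : L → ℝ
  Pstar_nonpos : ∀ i, Pstar i ≤ 0

namespace Microgrid

/-- Source voltages of a voltage vector `V = col(V_s, V_l)`. -/
def src {S L : Type*} (V : S ⊕ L → ℝ) : S → ℝ := fun i => V (Sum.inl i)

/-- Load voltages of a voltage vector `V = col(V_s, V_l)`. -/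
def load {S L : Type*} (V : S ⊕ L → ℝ) : L → ℝ := fun i => V (Sum.inr i)

/-- The positive orthant. -/
def posOrthant (N : Type*) : Set (N → ℝ) := {V | ∀ i, 0 < V i}

noncomputable section

open scoped Classical in
/-- Oriented incidence matrix of the electrical network. -/
def incidence {S L : Type*} (G : Microgrid S L) : Matrix (S ⊕ L) G.grid.edgeSet ℝ :=
  Matrix.of fun v e => (if v = G.head e then 1 else 0) - (if v = G.tail e then 1 else 0)

variable {S L : Type*} [Fintype S] [Fintype L] [DecidableEq S] [DecidableEq L]

open scoped Classical in
/-- The conductance matrix `B Γ Bᵀ`, with `Γ` the diagonal matrix of line conductances. -/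
def Y (G : Microgrid S L) : Matrix (S ⊕ L) (S ⊕ L) ℝ :=
  G.incidence * Matrix.diagonal (fun e => (G.r e)⁻¹) * G.incidenceᵀ

/-- The blocks of the conductance matrix. -/
def Yss (G : Microgrid S L) : Matrix S S ℝ := G.Y.toBlocks₁₁
def Ysl (G : Microgrid S L) : Matrix S L ℝ := G.Y.toBlocks₁₂
def Yls (G : Microgrid S L) : Matrix L S ℝ := G.Y.toBlocks₂₁
def Yll (G : Microgrid S L) : Matrix L L ℝ := G.Y.toBlocks₂₂

/-- The Kron-reduced conductance matrix. -/
def Yred (G : Microgrid S L) : Matrix S S ℝ := G.Yss - G.Ysl * G.Yll⁻¹ * G.Yls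

open scoped Classical in
/-- The Laplacian (degree matrix minus adjacency matrix) of the communication graph. -/
def Lc (G : Microgrid S L) : Matrix S S ℝ := G.comm.lapMatrix ℝ

/-- Source power injections `P_s = [V_s] (Y_ss V_s + Y_sl V_l)`. -/
def sourcePower (G : Microgrid S L) (V : S ⊕ L → ℝ) : S → ℝ :=
  src V * (G.Yss *ᵥ src V + G.Ysl *ᵥ load V)

/-- ZIP load currents `I_l(V_l) = I_l^* - Y_l^* V_l + [V_l]⁻¹ P_l^*`. -/
def loadCurrent (G : Microgrid S L) (Vl : L → ℝ) : L → ℝ :=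
  G.Istar - Matrix.diagonal G.Ystar *ᵥ Vl + Matrix.diagonal (fun i => (Vl i)⁻¹) *ᵥ G.Pstar

/-- Solutions on the time interval `J` of the closed-loop differential-algebraic system
`C_s V̇_s = -[V_s] L_c C_s⁻¹ P_s`, `-I_l(V_l) = -(Y_ls V_s + Y_ll V_l)`: continuous trajectories
whose source voltages are differentiable (one-sidedly at an end point of `J`) and which satisfy
both equations on `J`. Neither positivity nor boundedness of the voltages is part of the
definition. -/
structure IsSolutionOn (G : Microgrid S L) (J : Set ℝ) (V : ℝ → S ⊕ L → ℝ) : Prop where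
  continuousOn : ContinuousOn V J
  source : ∀ t ∈ J, ∃ dVs : S → ℝ,
    HasDerivWithinAt (fun τ => src (V τ)) dVs J t ∧
      Matrix.diagonal G.C *ᵥ dVs =
        -((Matrix.diagonal (src (V t)) * G.Lc * Matrix.diagonal (fun i => (G.C i)⁻¹)) *ᵥ
            G.sourcePower (V t))
  algebraic : ∀ t ∈ J,
    -G.loadCurrent (load (V t)) = -(G.Yls *ᵥ src (V t) + G.Yll *ᵥ load (V t))

/-- Current balance at the loads. -/
def currentBalance (G : Microgrid S L) (V : S ⊕ L → ℝ) : L → ℝ :=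
  G.loadCurrent (load V) - G.Yll *ᵥ load V - G.Yls *ᵥ src V

/-- The steady-state source injections `- C_s 𝟙 (𝟙ᵀ I_l(V_l)) / (𝟙ᵀ [V_s]⁻¹ C_s 𝟙)`. -/
def steadyPower (G : Microgrid S L) (V : S ⊕ L → ℝ) : S → ℝ :=
  fun i => -(G.C i * ((∑ j, G.loadCurrent (load V) j) / ∑ j, (src V j)⁻¹ * G.C j))

/-- Power balance at the sources. -/
def powerBalance (G : Microgrid S L) (V : S ⊕ L → ℝ) : S → ℝ :=
  src V * (G.Yred *ᵥ src V) + src V * ((G.Ysl * G.Yll⁻¹) *ᵥ G.loadCurrent (load V))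
    - G.steadyPower V

/-- The equilibrium set `ℰ_ZIP`. -/
def equilibria (G : Microgrid S L) : Set (S ⊕ L → ℝ) :=
  {V | V ∈ posOrthant (S ⊕ L) ∧ G.currentBalance V = 0 ∧ G.powerBalance V = 0}

/-- The positive definiteness condition
`Y_ll + Y_l^* + [V̄_l]⁻² [P_l^*] - Y_ls (Y_ss + [V̄_s]⁻² [P̄_s])⁻¹ Y_sl > 0`, where `P̄_s` is the
source power injection at `V̄`. -/
def MainCondition (G : Microgrid S L) (Vbar : S ⊕ L → ℝ) : Prop :=
  (G.Yll + Matrix.diagonal G.Ystar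
    + Matrix.diagonal (fun i => (load Vbar i ^ 2)⁻¹ * G.Pstar i)
    - G.Yls * (G.Yss + Matrix.diagonal (fun i => (src Vbar i ^ 2)⁻¹ * G.sourcePower Vbar i))⁻¹
        * G.Ysl).PosDef

/-- The energy function `M = J + H + K` associated with `V̄`. -/
def energy (G : Microgrid S L) (Vbar V : S ⊕ L → ℝ) : ℝ :=
  (1 / 2) * (V ⬝ᵥ ((G.Y + Matrix.fromBlocks 0 0 0 (Matrix.diagonal G.Ystar)) *ᵥ V))
    - ∑ i, G.sourcePower Vbar i * Real.log (src V i)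
    - ∑ i, G.Pstar i * Real.log (load V i)

/-- The Bregman function `ℳ` of the energy function, centred at `V̄`. -/
def bregman (G : Microgrid S L) (Vbar V : S ⊕ L → ℝ) : ℝ :=
  G.energy Vbar V - G.energy Vbar Vbar - fderiv ℝ (G.energy Vbar) Vbar (V - Vbar)

/-- The sublevel set of `ℳ` around `V̄` at level `c`: the connected component containing `V̄` of
`{V > 0 : ℳ(V) ≤ c}`. (With constant power loads `ℳ` tends to `-∞` as a load voltage tends
to `0`, so only the part of the sublevel set around `V̄` can be compact.) -/
def sublevel (G : Microgrid S L) (Vbar : S ⊕ L → ℝ) (c : ℝ) : Set (S ⊕ L → ℝ) :=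
  connectedComponentIn {V | V ∈ posOrthant (S ⊕ L) ∧ G.bregman Vbar V ≤ c} Vbar

/-- The weighted geometric mean `∏ V_i ^ C_i` of the source voltages. -/
def geomMean (G : Microgrid S L) (V : S ⊕ L → ℝ) : ℝ := ∏ i, src V i ^ G.C i

/-- The set `𝒱_ZIP` for the set `Λ` and the initial condition `V0`. -/
def meanSet (G : Microgrid S L) (Λ : Set (S ⊕ L → ℝ)) (V0 : S ⊕ L → ℝ) : Set (S ⊕ L → ℝ) :=
  {V | V ∈ Λ ∧ G.currentBalance V = 0 ∧ G.geomMean V = G.geomMean V0}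

end

end Microgrid

/-!
The load part of `∇ℳ` is a difference of current balances and the positive definiteness condition is
a Schur complement of the Hessian of `M` at `V̄`. Its source block is positive definite since the
loads only consume, which makes the injections at equilibrium nonnegative. Hence `ℳ` has a strict
local minimum at `V̄`, its small sublevel sets around `V̄` are compact, and by the implicit function
theorem the load equations determine the load voltages there, which turns (1) into an ordinary
differential equation for the source voltages. Along solutions `dℳ/dt = -uᵀ L_c u ≤ 0` with
`u = C_s⁻¹ P_s`, because `ū` is a multiple of `𝟙`, so solutions stay in the sublevel set and exist
for all times; `𝟙ᵀ L_c = 0` preserves the weighted geometric mean. By Barbalat's lemma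
`uᵀ L_c u → 0`, and where it vanishes `u` is a multiple of `𝟙`, which together with the
load equations characterizes equilibria.
-/

section SublevelComponent

variable {X : Type*} [TopologicalSpace X] {f : X → ℝ} {s U : Set X} {x₀ : X} {c : ℝ}

lemma connectedComponentIn_sublevel_subset_interior {K : Set X} (hK : IsClosed K)
    (hx₀ : x₀ ∈ interior K) (hfrontier : ∀ x ∈ frontier K, c < f x) :
    connectedComponentIn {x | x ∈ s ∧ f x ≤ c} x₀ ⊆ interior K := by
  by_cases hmem : x₀ ∈ {x | x ∈ s ∧ f x ≤ c}
  · refine isPreconnected_connectedComponentIn.subset_left_of_subset_union isOpen_interior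
      hK.isOpen_compl (disjoint_compl_right.mono_left interior_subset) (fun x hx => ?_)
      ⟨x₀, mem_connectedComponentIn hmem, hx₀⟩
    by_contra hx'
    rw [mem_union, not_or, mem_compl_iff, not_not] at hx'
    exact ((connectedComponentIn_subset _ _ hx).2).not_gt
      (hfrontier x ⟨subset_closure hx'.2, hx'.1⟩)
  · simp [connectedComponentIn_eq_empty hmem]

lemma isCompact_connectedComponentIn_sublevel [T2Space X] {K : Set X} (hK : IsCompact K)
    (hKs : K ⊆ s) (hf : ContinuousOn f K)
    (hsub : connectedComponentIn {x | x ∈ s ∧ f x ≤ c} x₀ ⊆ K) :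
    IsCompact (connectedComponentIn {x | x ∈ s ∧ f x ≤ c} x₀) := by
  refine hK.of_isClosed_subset (isClosed_of_closure_subset fun x hx => ?_) hsub
  have hclosed : IsClosed (K ∩ f ⁻¹' Iic c) :=
    hf.preimage_isClosed_of_isClosed hK.isClosed isClosed_Iic
  have hclosure : closure (connectedComponentIn {x | x ∈ s ∧ f x ≤ c} x₀) ⊆ K ∩ f ⁻¹' Iic c :=
    closure_minimal (fun y hy => ⟨hsub hy, (connectedComponentIn_subset _ _ hy).2⟩) hclosed
  have hx₀ : x₀ ∈ {x | x ∈ s ∧ f x ≤ c} :=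
    connectedComponentIn_nonempty_iff.1 (closure_nonempty_iff.1 (nonempty_of_mem hx))
  have hT : closure (connectedComponentIn {x | x ∈ s ∧ f x ≤ c} x₀) ⊆ {x | x ∈ s ∧ f x ≤ c} :=
    fun y hy => ⟨hKs (hclosure hy).1, (hclosure hy).2⟩
  exact isPreconnected_connectedComponentIn.closure.subset_connectedComponentIn
    (subset_closure (mem_connectedComponentIn hx₀)) hT hx

theorem exists_isCompact_connectedComponentIn_sublevel [T2Space X] [LocallyCompactSpace X]
    [LocallyConnectedSpace X] (hf : ∀ᶠ x in 𝓝 x₀, ContinuousAt f x)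
    (hmin : ∀ᶠ x in 𝓝[≠] x₀, f x₀ < f x) (hs : s ∈ 𝓝 x₀) (hU : U ∈ 𝓝 x₀) :
    ∃ c > f x₀, IsCompact (connectedComponentIn {x | x ∈ s ∧ f x ≤ c} x₀) ∧
      connectedComponentIn {x | x ∈ s ∧ f x ≤ c} x₀ ⊆ U ∧
      connectedComponentIn {x | x ∈ s ∧ f x ≤ c} x₀ ∈ 𝓝 x₀ := by
  obtain ⟨K, hK, hKsub, hKc⟩ := local_compact_nhds
    (inter_mem (inter_mem hs hU) (inter_mem hf (eventually_nhdsWithin_iff.1 hmin)))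
  have hcont : ContinuousOn f K := fun x hx => (hKsub hx).2.1.continuousWithinAt
  have hx₀ : x₀ ∈ interior K := mem_interior_iff_mem_nhds.2 hK
  have hfrontier : ∀ x ∈ frontier K, f x₀ < f x := fun x hx =>
    (hKsub (hKc.isClosed.frontier_subset hx)).2.2 fun h => hx.2 (h ▸ hx₀)
  obtain ⟨c, hc, hcK⟩ : ∃ c > f x₀, ∀ x ∈ frontier K, c < f x := by
    have hbdry : IsCompact (frontier K) :=
      hKc.of_isClosed_subset isClosed_frontier hKc.isClosed.frontier_subset
    rcases (frontier K).eq_empty_or_nonempty with hempty | hne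
    · exact ⟨f x₀ + 1, by linarith, by simp [hempty]⟩
    · obtain ⟨z, hz, hzmin⟩ := hbdry.exists_isMinOn hne
        (hcont.mono hKc.isClosed.frontier_subset)
      obtain ⟨c, hc, hcz⟩ := exists_between (hfrontier z hz)
      exact ⟨c, hc, fun x hx => hcz.trans_le (hzmin hx)⟩
  have hsub := (connectedComponentIn_sublevel_subset_interior (s := s) hKc.isClosed hx₀ hcK).trans
    interior_subset
  refine ⟨c, hc,
    isCompact_connectedComponentIn_sublevel hKc (fun x hx => (hKsub hx).1.1) hcont hsub,
    hsub.trans fun x hx => (hKsub hx).1.2, connectedComponentIn_mem_nhds ?_⟩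
  filter_upwards [hs, hf.self_of_nhds.eventually_lt continuousAt_const hc] with x hxs hxc
    using ⟨hxs, hxc.le⟩

/-- Continuous induction: a curve that leaves the component does so inside `U`, where `f` decreases
along it, so that it cannot leave the sublevel set. -/
theorem mapsTo_connectedComponentIn_sublevel {V : ℝ → X} {a b : ℝ}
    (hclosed : IsClosed (connectedComponentIn {x | x ∈ s ∧ f x ≤ c} x₀))
    (hU : IsOpen U) (hUs : U ⊆ s) (hsub : connectedComponentIn {x | x ∈ s ∧ f x ≤ c} x₀ ⊆ U)
    (hV : ContinuousOn V (Icc a b)) (ha : V a ∈ connectedComponentIn {x | x ∈ s ∧ f x ≤ c} x₀)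
    (hanti : ∀ t τ, Icc t τ ⊆ Icc a b → MapsTo V (Icc t τ) U → AntitoneOn (f ∘ V) (Icc t τ)) :
    MapsTo V (Icc a b) (connectedComponentIn {x | x ∈ s ∧ f x ≤ c} x₀) := by
  set Λ := connectedComponentIn {x | x ∈ s ∧ f x ≤ c} x₀
  have hpre : IsClosed (V ⁻¹' Λ ∩ Icc a b) := by
    rw [inter_comm]
    exact hV.preimage_isClosed_of_isClosed isClosed_Icc hclosed
  refine hpre.Icc_subset_of_forall_mem_nhdsWithin ha fun t ht => ?_
  obtain ⟨htΛ, hta, htb⟩ := ht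
  have hnear : V ⁻¹' U ∈ 𝓝[Icc a b] t := hV t ⟨hta, htb.le⟩ (hU.mem_nhds (hsub htΛ))
  have hIcc : Icc a b ∈ 𝓝[≥] t := Icc_mem_nhdsGE_of_mem ⟨hta, htb⟩
  obtain ⟨τ, htτ, hτ⟩ := mem_nhdsGE_iff_exists_Icc_subset.1
    (inter_mem (nhdsWithin_le_of_mem hIcc hnear) hIcc)
  filter_upwards [Ioc_mem_nhdsGT htτ] with σ hσ
  have hσU : Icc t σ ⊆ V ⁻¹' U ∩ Icc a b := (Icc_subset_Icc_right hσ.2).trans hτ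
  have hVU : MapsTo V (Icc t σ) U := fun r hr => (hσU hr).1
  have hdecr := hanti t σ (hσU.trans inter_subset_right) hVU
  have himage : V '' Icc t σ ⊆ {x | x ∈ s ∧ f x ≤ c} := by
    rintro _ ⟨r, hr, rfl⟩
    exact ⟨hUs (hVU hr), (hdecr (left_mem_Icc.2 hσ.1.le) hr hr.1).trans
      (connectedComponentIn_subset _ _ htΛ).2⟩
  have hconn := isPreconnected_Icc.image V (hV.mono (hσU.trans inter_subset_right))
  have := hconn.subset_connectedComponentIn (mem_image_of_mem V (left_mem_Icc.2 hσ.1.le)) himage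
  rw [← connectedComponentIn_eq htΛ] at this
  exact this (mem_image_of_mem V (right_mem_Icc.2 hσ.1.le))

end SublevelComponent

section SecondDerivative

lemma isCoercive_of_forall_pos {E : Type*} [NormedAddCommGroup E] [NormedSpace ℝ E]
    [FiniteDimensional ℝ E] {B : E →L[ℝ] E →L[ℝ] ℝ} (hB : ∀ d, d ≠ 0 → 0 < B d d) :
    IsCoercive B := by
  have : ProperSpace E := FiniteDimensional.proper_real E
  have hsphere : ∀ d : E, d ≠ 0 → ‖d‖⁻¹ • d ∈ Metric.sphere (0 : E) 1 := fun d hd => by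
    simp [norm_smul, inv_mul_cancel₀ (norm_ne_zero_iff.2 hd)]
  rcases (Metric.sphere (0 : E) 1).eq_empty_or_nonempty with hempty | hne
  · refine ⟨1, one_pos, fun d => ?_⟩
    obtain rfl : d = 0 := by_contra fun hd => by simpa [hempty] using hsphere d hd
    simp
  · obtain ⟨e, he, hmin⟩ := (isCompact_sphere (0 : E) 1).exists_isMinOn hne
      (f := fun d => B d d) (by fun_prop)
    refine ⟨B e e, hB e (ne_zero_of_mem_unit_sphere ⟨e, he⟩), fun d => ?_⟩
    rcases eq_or_ne d 0 with rfl | hd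
    · simp
    · have hle : B e e ≤ ‖d‖⁻¹ * (‖d‖⁻¹ * B d d) := by simpa using hmin (hsphere d hd)
      calc B e e * ‖d‖ * ‖d‖ ≤ ‖d‖⁻¹ * (‖d‖⁻¹ * B d d) * ‖d‖ * ‖d‖ := by gcongr
        _ = B d d := by field_simp

variable {E : Type*} [NormedAddCommGroup E] [NormedSpace ℝ E] {φ : E → ℝ} {φ' : E → E →L[ℝ] ℝ}
  {x₀ : E}

lemma eventually_lt_of_hasFDerivAt_of_pos (hφ : ∀ᶠ x in 𝓝 x₀, HasFDerivAt φ (φ' x) x)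
    (hpos : ∀ᶠ x in 𝓝[≠] x₀, 0 < φ' x (x - x₀)) : ∀ᶠ x in 𝓝[≠] x₀, φ x₀ < φ x := by
  obtain ⟨ε, hε, hball⟩ := Metric.eventually_nhds_iff_ball.1
    (hφ.and (eventually_nhdsWithin_iff.1 hpos))
  refine eventually_nhdsWithin_iff.2 (Metric.eventually_nhds_iff_ball.2 ⟨ε, hε, fun x hx hne => ?_⟩)
  have hray : ∀ θ ∈ Icc (0 : ℝ) 1, AffineMap.lineMap x₀ x θ ∈ Metric.ball x₀ ε := fun θ hθ =>
    (convex_ball x₀ ε).lineMap_mem (Metric.mem_ball_self hε) hx hθ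
  have hderiv : ∀ θ ∈ Icc (0 : ℝ) 1, HasDerivAt (fun θ => φ (AffineMap.lineMap x₀ x θ))
      (φ' (AffineMap.lineMap x₀ x θ) (x - x₀)) θ := fun θ hθ =>
    (hball _ (hray θ hθ)).1.comp_hasDerivAt θ AffineMap.hasDerivAt_lineMap
  obtain ⟨θ, hθ, hslope⟩ := exists_hasDerivAt_eq_slope _ _ one_pos
    (fun θ hθ => (hderiv θ hθ).continuousAt.continuousWithinAt)
    fun θ hθ => hderiv θ (Ioo_subset_Icc_self hθ)
  have hsub : AffineMap.lineMap x₀ x θ - x₀ = θ • (x - x₀) := by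
    simp [AffineMap.lineMap_apply]
  have hθx : AffineMap.lineMap x₀ x θ ≠ x₀ := by
    rw [← sub_ne_zero, hsub]
    exact smul_ne_zero hθ.1.ne' (sub_ne_zero.2 hne)
  have h := (hball _ (hray θ (Ioo_subset_Icc_self hθ))).2 hθx
  rw [hsub, map_smul, hslope, smul_eq_mul] at h
  simpa using pos_of_mul_pos_right h hθ.1.le

theorem eventually_lt_of_isCoercive {φ'' : E →L[ℝ] E →L[ℝ] ℝ}
    (hφ : ∀ᶠ x in 𝓝 x₀, HasFDerivAt φ (φ' x) x) (hφ' : HasFDerivAt φ' φ'' x₀)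
    (hzero : φ' x₀ = 0) (hcoercive : IsCoercive φ'') : ∀ᶠ x in 𝓝[≠] x₀, φ x₀ < φ x := by
  obtain ⟨m, hm, hB⟩ := hcoercive
  refine eventually_lt_of_hasFDerivAt_of_pos hφ (eventually_nhdsWithin_iff.2 ?_)
  filter_upwards [(hasFDerivAt_iff_isLittleO.1 hφ').def (half_pos hm)] with x hx hne
  rw [hzero, sub_zero] at hx
  have hd := norm_pos_iff.2 (sub_ne_zero.2 hne)
  have herror : |φ' x (x - x₀) - φ'' (x - x₀) (x - x₀)| ≤ m / 2 * ‖x - x₀‖ * ‖x - x₀‖ :=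
    ((φ' x - φ'' (x - x₀)).le_opNorm (x - x₀)).trans (by gcongr)
  nlinarith [(abs_le.1 herror).1, hB (x - x₀), mul_pos hm (mul_pos hd hd)]

end SecondDerivative

section LipschitzExtension

variable {ι : Type*} [Fintype ι]

lemma exists_bounded_lipschitzWith_eqOn {α : Type*} [PseudoMetricSpace α] {f : α → ι → ℝ}
    {s : Set α} {K B : NNReal} (hf : LipschitzOnWith K f s) (hB : ∀ x ∈ s, ‖f x‖ ≤ B) :
    ∃ g : α → ι → ℝ, LipschitzWith K g ∧ (∀ x, ‖g x‖ ≤ B) ∧ EqOn f g s := by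
  obtain ⟨g, hg, hfg⟩ := hf.extend_pi
  have hb : -(B : ℝ) ≤ B := neg_le_self B.coe_nonneg
  refine ⟨fun x i => projIcc (-B : ℝ) B hb (g x i), LipschitzWith.of_dist_le_mul fun x y => ?_,
    fun x => (pi_norm_le_iff_of_nonneg B.coe_nonneg).2 fun i => abs_le.2 (projIcc _ _ hb _).2,
    fun x hx => funext fun i => ?_⟩
  · refine (dist_pi_le_iff (by positivity)).2 fun i => ?_
    calc dist (projIcc (-B : ℝ) B hb (g x i) : ℝ) (projIcc (-B : ℝ) B hb (g y i))
        ≤ dist (g x i) (g y i) := by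
          simpa only [NNReal.coe_one, one_mul, Subtype.dist_eq] using
            (LipschitzWith.projIcc hb).dist_le_mul (g x i) (g y i)
      _ ≤ K * dist x y := (dist_le_pi_dist _ _ i).trans (hg.dist_le_mul x y)
  · have hi := abs_le.1 ((norm_le_pi_norm (f x) i).trans (hB x hx))
    simp only [← hfg hx, projIcc_of_mem hb hi]

lemma exists_bounded_lipschitzWith_eventuallyEq {E : Type*} [NormedAddCommGroup E]
    [NormedSpace ℝ E] {f : E → ι → ℝ} {x₀ : E} (hf : ContDiffAt ℝ 1 f x₀) :
    ∃ (g : E → ι → ℝ) (K B : NNReal), LipschitzWith K g ∧ (∀ x, ‖g x‖ ≤ B) ∧ f =ᶠ[𝓝 x₀] g := by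
  obtain ⟨K, s, hs, hlip⟩ := hf.exists_lipschitzOnWith
  have hbound : ∀ᶠ x in 𝓝 x₀, ‖f x‖ < ‖f x₀‖₊ + 1 :=
    hf.continuousAt.norm.eventually_lt continuousAt_const (by simp)
  obtain ⟨g, hg, hgB, hfg⟩ := exists_bounded_lipschitzWith_eqOn (B := ‖f x₀‖₊ + 1)
    (hlip.mono inter_subset_left) fun x (hx : x ∈ s ∩ {x | ‖f x‖ < ‖f x₀‖₊ + 1}) => hx.2.le
  exact ⟨g, K, _, hg, hgB, hfg.eventuallyEq_of_mem (inter_mem hs hbound)⟩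

end LipschitzExtension

section Curves

variable {E : Type*} [NormedAddCommGroup E] [NormedSpace ℝ E]

lemma norm_sub_sub_smul_le_of_norm_deriv_sub_le {f g : ℝ → E} {a b C : ℝ} (hab : a ≤ b)
    (hf : ∀ t ∈ Icc a b, HasDerivWithinAt f (g t) (Icc a b) t)
    (hg : ∀ t ∈ Icc a b, ‖g t - g a‖ ≤ C) :
    ‖f b - f a - (b - a) • g a‖ ≤ C * (b - a) := by
  have h := (convex_Icc a b).norm_image_sub_le_of_norm_hasDerivWithin_le
    (f := fun t => f t - t • g a) (f' := fun t => g t - (1 : ℝ) • g a) (C := C)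
    (fun t ht => (hf t ht).sub ((hasDerivWithinAt_id t _).smul_const (g a)))
    (by simpa only [one_smul] using hg) (left_mem_Icc.2 hab) (right_mem_Icc.2 hab)
  rw [Real.norm_of_nonneg (sub_nonneg.2 hab)] at h
  convert h using 2
  rw [sub_smul]
  abel

/-- Barbalat's lemma. -/
theorem tendsto_zero_of_tendsto_of_uniformContinuousOn_deriv {f g : ℝ → E} {a : ℝ} {l : E}
    (hf : ∀ t ∈ Ici a, HasDerivWithinAt f (g t) (Ici a) t) (hg : UniformContinuousOn g (Ici a))
    (hl : Tendsto f atTop (𝓝 l)) : Tendsto g atTop (𝓝 0) := by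
  rw [Metric.tendsto_atTop]
  intro ε hε
  obtain ⟨δ, hδ, hgδ⟩ := Metric.uniformContinuousOn_iff_le.1 hg (ε / 2) (half_pos hε)
  have hincr : Tendsto (fun t => f (t + δ) - f t) atTop (𝓝 0) := by
    simpa using (hl.comp (tendsto_atTop_add_const_right _ δ tendsto_id)).sub hl
  obtain ⟨T, hT⟩ := Metric.tendsto_atTop.1 hincr (δ * (ε / 2)) (by positivity)
  refine ⟨max T a, fun t ht => ?_⟩
  have hta : a ≤ t := le_of_max_le_right ht
  have hsub : Icc t (t + δ) ⊆ Ici a := fun r hr => hta.trans hr.1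
  have hmean := norm_sub_sub_smul_le_of_norm_deriv_sub_le (C := ε / 2) (by linarith : t ≤ t + δ)
    (fun r hr => (hf r (hsub hr)).mono hsub) fun r hr => by
      rw [← dist_eq_norm]
      refine hgδ r (hsub hr) t hta ?_
      rw [Real.dist_eq, abs_of_nonneg (sub_nonneg.2 hr.1)]
      linarith [hr.2]
  have hfδ := hT t (le_of_max_le_left ht)
  have hδg := norm_le_norm_add_norm_sub (f (t + δ) - f t) (δ • g t)
  rw [add_sub_cancel_left] at hmean
  rw [norm_smul, Real.norm_of_nonneg hδ.le] at hδg
  rw [dist_zero_right] at hfδ ⊢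
  nlinarith

lemma exists_tendsto_of_antitoneOn_Ici {f : ℝ → ℝ} {a : ℝ} (hf : AntitoneOn f (Ici a))
    (hb : BddBelow (f '' Ici a)) : ∃ l, Tendsto f atTop (𝓝 l) := by
  have hanti : Antitone fun t => f (max a t) := fun t τ h =>
    hf (le_max_left a t) (le_max_left a τ) (max_le_max_left a h)
  refine ⟨_, (tendsto_atTop_ciInf hanti (hb.mono ?_)).congr' ?_⟩
  · rintro _ ⟨t, rfl⟩
    exact mem_image_of_mem f (le_max_left a t)
  · filter_upwards [eventually_ge_atTop a] with t ht
    rw [max_eq_right ht]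

end Curves

section IntegralCurves

variable {E : Type*} [NormedAddCommGroup E] [NormedSpace ℝ E] {F : E → E} {K B : NNReal}

lemma exists_eq_forall_mem_Ioo_hasDerivAt_of_lipschitzWith [CompleteSpace E]
    (hF : LipschitzWith K F) (hB : ∀ x, ‖F x‖ ≤ B) (x₀ : E) {T : ℝ} (hT : 0 ≤ T) :
    ∃ y : ℝ → E, y 0 = x₀ ∧ ∀ t ∈ Ioo (-T) T, HasDerivAt y (F (y t)) t := by
  have hPL : IsPicardLindelof (fun _ => F) (⟨0, by linarith, hT⟩ : Icc (-T) T) x₀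
      (B * T.toNNReal) 0 B K :=
    { lipschitzOnWith := fun _ _ => hF.lipschitzOnWith
      continuousOn := fun _ _ => continuousOn_const
      norm_le := fun _ _ x _ => hB x
      mul_max_le := by simp [hT] }
  obtain ⟨y, hy₀, hy⟩ := hPL.exists_eq_forall_mem_Icc_hasDerivWithinAt₀
  exact ⟨y, hy₀, fun t ht => (hy t (Ioo_subset_Icc_self ht)).hasDerivAt (Icc_mem_nhds ht.1 ht.2)⟩

theorem exists_forall_hasDerivAt_of_lipschitzWith_of_norm_le [CompleteSpace E]
    (hF : LipschitzWith K F) (hB : ∀ x, ‖F x‖ ≤ B) (x₀ : E) :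
    ∃ y : ℝ → E, y 0 = x₀ ∧ ∀ t, HasDerivAt y (F (y t)) t := by
  choose y hy₀ hy using fun n : ℕ =>
    exists_eq_forall_mem_Ioo_hasDerivAt_of_lipschitzWith hF hB x₀ (T := n) n.cast_nonneg
  have agree : ∀ n m : ℕ, ∀ t : ℝ, |t| < n → |t| < m → y n t = y m t := by
    have agree_of_le : ∀ n m : ℕ, n ≤ m → EqOn (y n) (y m) (Ioo (-n : ℝ) n) := by
      intro n m hnm t ht
      have hsub : Ioo (-n : ℝ) n ⊆ Ioo (-m : ℝ) m := by
        have : (n : ℝ) ≤ m := by exact_mod_cast hnm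
        exact Ioo_subset_Ioo (neg_le_neg this) this
      have hn : (0 : ℝ) ∈ Ioo (-n : ℝ) n := by
        have := ht.1.trans ht.2
        exact ⟨by linarith, by linarith⟩
      exact ODE_solution_unique_of_mem_Ioo (v := fun _ => F) (s := fun _ => univ) (K := K)
        (fun _ _ => hF.lipschitzOnWith) hn (fun t ht => ⟨hy n t ht, trivial⟩)
        (fun t ht => ⟨hy m t (hsub ht), trivial⟩) (by rw [hy₀, hy₀]) ht
    intro n m t hn hm
    rcases le_total n m with h | h
    · exact agree_of_le n m h (abs_lt.1 hn)
    · exact (agree_of_le m n h (abs_lt.1 hm)).symm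
  have hlt : ∀ t : ℝ, |t| < (⌊|t|⌋₊ + 1 : ℕ) := fun t => by exact_mod_cast Nat.lt_floor_add_one |t|
  refine ⟨fun t => y (⌊|t|⌋₊ + 1) t, by simp [hy₀], fun t => ?_⟩
  refine (hy (⌊|t|⌋₊ + 1) t (abs_lt.1 (hlt t))).congr_of_eventuallyEq ?_
  filter_upwards [continuous_abs.continuousAt.eventually_lt continuousAt_const (hlt t)] with τ hτ
    using agree _ _ τ (hlt τ) hτ

end IntegralCurves

theorem tendsto_infEDist_of_tendsto_zero {X : Type*} [PseudoEMetricSpace X] {K : Set X}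
    (hK : IsCompact K) {q : X → ℝ} (hq : ContinuousOn q K) {V : ℝ → X}
    (hV : ∀ᶠ t in atTop, V t ∈ K) (hlim : Tendsto (fun t => q (V t)) atTop (𝓝 0)) :
    Tendsto (fun t => Metric.infEDist (V t) {x ∈ K | q x = 0}) atTop (𝓝 0) := by
  rw [ENNReal.tendsto_nhds_zero]
  intro ε hε
  by_contra hnot
  obtain ⟨t, ht, hfar⟩ := exists_seq_forall_of_frequently
    ((not_eventually.1 hnot).and_eventually hV)
  obtain ⟨x, hx, φ, hφ, hconv⟩ := hK.tendsto_subseq fun n => (hfar n).2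
  have hwithin : Tendsto (V ∘ t ∘ φ) atTop (𝓝[K] x) :=
    tendsto_nhdsWithin_iff.2 ⟨hconv, Eventually.of_forall fun n => (hfar (φ n)).2⟩
  have hqx : q x = 0 :=
    tendsto_nhds_unique ((hq x hx).tendsto.comp hwithin) (hlim.comp (ht.comp hφ.tendsto_atTop))
  obtain ⟨n, hn⟩ := (ENNReal.tendsto_nhds_zero.1 (tendsto_iff_edist_tendsto_0.1 hconv) ε hε).exists
  have hmem : x ∈ {x ∈ K | q x = 0} := ⟨hx, hqx⟩
  exact (hfar (φ n)).1 ((Metric.infEDist_le_edist_of_mem hmem).trans hn)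

section LinearAlgebra

lemma posDef_fromBlocks_of_schurComplement {m n : Type*} [Fintype m] [Finite n] [DecidableEq m]
    {A : Matrix m m ℝ} {B : Matrix m n ℝ} {D : Matrix n n ℝ} (hA : A.PosDef)
    (hS : (D - Bᴴ * A⁻¹ * B).PosDef) : (fromBlocks A B Bᴴ D).PosDef := by
  have := Fintype.ofFinite n
  have := hA.isUnit.invertible
  refine .of_dotProduct_mulVec_pos
    ((IsHermitian.fromBlocks₁₁ _ _ hA.isHermitian).2 hS.isHermitian) fun d hd => ?_
  have hsquare := schur_complement_eq₁₁ B D (d ∘ Sum.inl) (d ∘ Sum.inr) hA.isHermitian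
  simp only [Sum.elim_comp_inl_inr, ← dotProduct_mulVec] at hsquare
  rw [hsquare]
  rcases eq_or_ne (d ∘ Sum.inr) 0 with hr | hr
  · have hl : d ∘ Sum.inl ≠ 0 := fun hl => hd <| by
      rw [← Sum.elim_comp_inl_inr d, hl, hr, Sum.elim_zero_zero]
    simpa [hr] using hA.dotProduct_mulVec_pos hl
  · exact add_pos_of_nonneg_of_pos (hA.posSemidef.dotProduct_mulVec_nonneg _)
      (hS.dotProduct_mulVec_pos hr)

variable {N : Type*} [Fintype N]

/-- The dot product as a continuous bilinear map; `dotProductCLM w` is the functional with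
gradient `w`. -/
noncomputable def dotProductCLM : (N → ℝ) →L[ℝ] (N → ℝ) →L[ℝ] ℝ :=
  (dotProductBilin ℝ ℝ).toContinuousBilinearMap

lemma dotProductCLM_apply (v w : N → ℝ) : dotProductCLM v w = v ⬝ᵥ w := rfl

lemma hasFDerivAt_dotProduct_mulVec_self {A : Matrix N N ℝ} (hA : A.IsSymm) (x : N → ℝ) :
    HasFDerivAt (fun x => (1 / 2) * (x ⬝ᵥ A *ᵥ x)) (dotProductCLM (A *ᵥ x)) x := by
  have h := (dotProductCLM.hasFDerivAt_of_bilinear (hasFDerivAt_id x)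
    (A.mulVecLin.toContinuousLinearMap.hasFDerivAt (x := x))).const_mul (1 / 2 : ℝ)
  refine h.congr_fderiv (ContinuousLinearMap.ext fun d => ?_)
  have hsymm : x ⬝ᵥ A *ᵥ d = A *ᵥ x ⬝ᵥ d := by rw [dotProduct_mulVec, ← mulVec_transpose, hA]
  simp [dotProductCLM_apply, hsymm, dotProduct_comm d]
  ring

end LinearAlgebra

section ImplicitFunction

theorem exists_contDiffAt_eventually_eq_iff_of_injective {ι κ : Type*} [Fintype ι] [Fintype κ]
    {f : (ι ⊕ κ → ℝ) → κ → ℝ} {f' : (ι ⊕ κ → ℝ) →L[ℝ] κ → ℝ} {x : ι ⊕ κ → ℝ}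
    (hf : ContDiffAt ℝ 1 f x) (hf' : HasFDerivAt f f' x)
    (hinj : ∀ v : κ → ℝ, f' (Sum.elim 0 v) = 0 → v = 0) :
    ∃ η : (ι → ℝ) → κ → ℝ, ContDiffAt ℝ 1 η (x ∘ Sum.inl) ∧
      ∀ᶠ y in 𝓝 x, f y = f x ↔ η (y ∘ Sum.inl) = y ∘ Sum.inr := by
  let e := ContinuousLinearEquiv.sumPiEquivProdPi ℝ ι κ fun _ => ℝ
  have hx : e.symm (e x) = x := e.symm_apply_apply x
  have hg : ContDiffAt ℝ 1 (f ∘ e.symm) (e x) :=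
    ContDiffAt.comp (e x) (hx.symm ▸ hf) e.symm.contDiff.contDiffAt
  have hg' : HasFDerivAt (f ∘ e.symm) (f' ∘L (e.symm : _ →L[ℝ] ι ⊕ κ → ℝ)) (e x) :=
    HasFDerivAt.comp (e x) (hx.symm ▸ hf') e.symm.hasFDerivAt
  have hinr : Function.Injective
      ((f' ∘L (e.symm : _ →L[ℝ] ι ⊕ κ → ℝ)) ∘L .inr ℝ (ι → ℝ) (κ → ℝ) : (κ → ℝ) →ₗ[ℝ] κ → ℝ) := by
    refine (injective_iff_map_eq_zero _).2 fun v hv => hinj v ?_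
    rwa [show (Sum.elim 0 v : ι ⊕ κ → ℝ) = e.symm (0, v) from funext <| Sum.rec (fun _ => rfl)
      fun _ => rfl]
  have hinv : (fderiv ℝ (f ∘ e.symm) (e x) ∘L .inr ℝ (ι → ℝ) (κ → ℝ)).IsInvertible := by
    rw [hg'.fderiv]
    exact ⟨(LinearEquiv.ofInjectiveEndo _ hinr).toContinuousLinearEquiv, rfl⟩
  refine ⟨hg.implicitFunction one_ne_zero hinv, hg.contDiffAt_implicitFunction one_ne_zero hinv, ?_⟩
  filter_upwards [e.continuous.continuousAt.eventually
    (hg.eventually_apply_eq_iff_implicitFunction one_ne_zero hinv)] with y hy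
  rwa [Function.comp_apply, Function.comp_apply, e.symm_apply_apply, hx] at hy

end ImplicitFunction

namespace Microgrid

noncomputable section

section PosOrthant

lemma continuous_src {S L : Type*} : Continuous (src : (S ⊕ L → ℝ) → S → ℝ) :=
  continuous_pi fun i => continuous_apply (Sum.inl i)

lemma posOrthant_mem_nhds {N : Type*} [Finite N] {x : N → ℝ} (hx : x ∈ posOrthant N) :
    posOrthant N ∈ 𝓝 x :=
  eventually_all.2 fun i => (continuous_apply i).continuousAt.eventually_const_lt (hx i)

lemma ne_zero_of_mem_posOrthant {N : Type*} {x : N → ℝ} (hx : x ∈ posOrthant N) (i : N) :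
    x i ≠ 0 := (hx i).ne'

end PosOrthant

section Network

variable {S L : Type*} [Fintype S] [Fintype L]

lemma transpose_incidence_mulVec (G : Microgrid S L) (x : S ⊕ L → ℝ) (e : G.grid.edgeSet) :
    (G.incidenceᵀ *ᵥ x) e = x (G.head e) - x (G.tail e) := by
  simp [mulVec, dotProduct, incidence, sub_mul, Finset.sum_sub_distrib]

variable [DecidableEq S] [DecidableEq L]

lemma Y_isSymm (G : Microgrid S L) : G.Y.IsSymm := by
  classical
  rw [Matrix.IsSymm, Y, transpose_mul, transpose_mul, diagonal_transpose, transpose_transpose,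
    Matrix.mul_assoc]

open scoped Classical in
lemma dotProduct_Y_mulVec (G : Microgrid S L) (x y : S ⊕ L → ℝ) :
    x ⬝ᵥ G.Y *ᵥ y =
      ∑ e, (G.r e)⁻¹ * ((x (G.head e) - x (G.tail e)) * (y (G.head e) - y (G.tail e))) := by
  rw [Y, ← mulVec_mulVec, ← mulVec_mulVec, dotProduct_mulVec, ← mulVec_transpose]
  simp only [dotProduct, mulVec_diagonal, transpose_incidence_mulVec]
  exact Finset.sum_congr rfl fun e _ => mul_left_comm _ _ _

lemma dotProduct_Y_mulVec_self_nonneg (G : Microgrid S L) (x : S ⊕ L → ℝ) :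
    0 ≤ x ⬝ᵥ G.Y *ᵥ x := by
  classical
  rw [dotProduct_Y_mulVec]
  exact Finset.sum_nonneg fun e _ => mul_nonneg (inv_nonneg.2 (G.r_pos e).le) (mul_self_nonneg _)

lemma eq_of_adj_of_dotProduct_Y_mulVec_self_eq_zero (G : Microgrid S L) {x : S ⊕ L → ℝ}
    (hx : x ⬝ᵥ G.Y *ᵥ x = 0) {i j : S ⊕ L} (hij : G.grid.Adj i j) : x i = x j := by
  classical
  rw [dotProduct_Y_mulVec, Finset.sum_eq_zero_iff_of_nonneg fun e _ =>
    mul_nonneg (inv_nonneg.2 (G.r_pos e).le) (mul_self_nonneg _)] at hx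
  let e : G.grid.edgeSet := ⟨s(i, j), hij⟩
  have he : x (G.head e) = x (G.tail e) := sub_eq_zero.1 <| mul_self_eq_zero.1 <|
    (mul_eq_zero.1 (hx e (Finset.mem_univ e))).resolve_left (inv_pos.2 (G.r_pos e)).ne'
  rcases Sym2.eq_iff.1 (G.edge_eq e) with ⟨hi, hj⟩ | ⟨hi, hj⟩
  · rw [hi, hj, he]
  · rw [hi, hj, he]

lemma eq_of_dotProduct_Y_mulVec_self_eq_zero (G : Microgrid S L) {x : S ⊕ L → ℝ}
    (hx : x ⬝ᵥ G.Y *ᵥ x = 0) (i j : S ⊕ L) : x i = x j := by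
  obtain ⟨p⟩ := G.grid_connected.preconnected i j
  induction p with
  | nil => rfl
  | cons h _ ih => exact (G.eq_of_adj_of_dotProduct_Y_mulVec_self_eq_zero hx h).trans ih

lemma dotProduct_Y_mulVec_self_pos (G : Microgrid S L) {x : S ⊕ L → ℝ} {i j : S ⊕ L}
    (hij : x i ≠ x j) : 0 < x ⬝ᵥ G.Y *ᵥ x :=
  (G.dotProduct_Y_mulVec_self_nonneg x).lt_of_ne fun h =>
    hij (G.eq_of_dotProduct_Y_mulVec_self_eq_zero h.symm i j)

lemma sum_Y_mulVec (G : Microgrid S L) (x : S ⊕ L → ℝ) : ∑ i, (G.Y *ᵥ x) i = 0 := by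
  classical
  simpa [dotProduct] using G.dotProduct_Y_mulVec 1 x

lemma Y_eq_fromBlocks (G : Microgrid S L) : G.Y = fromBlocks G.Yss G.Ysl G.Yls G.Yll :=
  (fromBlocks_toBlocks _).symm

lemma Ysl_conjTranspose (G : Microgrid S L) : G.Yslᴴ = G.Yls := by
  ext i j
  exact G.Y_isSymm.apply _ _

lemma Y_mulVec (G : Microgrid S L) (V : S ⊕ L → ℝ) :
    G.Y *ᵥ V = Sum.elim (G.Yss *ᵥ src V + G.Ysl *ᵥ load V) (G.Yls *ᵥ src V + G.Yll *ᵥ load V) := by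
  rw [Y_eq_fromBlocks, fromBlocks_mulVec]
  rfl

lemma Yss_posDef [Nonempty L] (G : Microgrid S L) : G.Yss.PosDef := by
  refine .of_dotProduct_mulVec_pos (IsHermitian.ext fun i j => G.Y_isSymm.apply _ _) fun x hx => ?_
  obtain ⟨i, hi⟩ := Function.ne_iff.1 hx
  have := G.dotProduct_Y_mulVec_self_pos (x := Sum.elim x 0) (i := Sum.inl i)
    (j := Sum.inr (Classical.arbitrary L)) hi
  simpa [Y_eq_fromBlocks, fromBlocks_mulVec] using this

lemma Yll_posDef (G : Microgrid S L) : G.Yll.PosDef := by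
  obtain ⟨s⟩ := G.comm_connected.nonempty
  refine .of_dotProduct_mulVec_pos (IsHermitian.ext fun i j => G.Y_isSymm.apply _ _) fun x hx => ?_
  obtain ⟨j, hj⟩ := Function.ne_iff.1 hx
  have := G.dotProduct_Y_mulVec_self_pos (x := Sum.elim 0 x) (i := Sum.inr j) (j := Sum.inl s) hj
  simpa [Y_eq_fromBlocks, fromBlocks_mulVec] using this

end Network

section Equilibria

variable {S L : Type*} [Fintype L] [DecidableEq L]

lemma loadCurrent_nonpos (G : Microgrid S L) {Vl : L → ℝ} (hVl : Vl ∈ posOrthant L) (j : L) :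
    G.loadCurrent Vl j ≤ 0 := by
  simp only [loadCurrent, Pi.add_apply, Pi.sub_apply, mulVec_diagonal]
  have hY := mul_nonneg (G.Ystar_nonneg j) (hVl j).le
  have hP := mul_nonpos_of_nonneg_of_nonpos (inv_nonneg.2 (hVl j).le) (G.Pstar_nonpos j)
  linarith [G.Istar_nonpos j]

variable [Fintype S] [DecidableEq S] {V : S ⊕ L → ℝ}

lemma currentBalance_eq_zero_iff (G : Microgrid S L) :
    G.currentBalance V = 0 ↔ G.loadCurrent (load V) = G.Yls *ᵥ src V + G.Yll *ᵥ load V := by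
  rw [currentBalance, sub_sub, sub_eq_zero, add_comm]

lemma powerBalance_eq (G : Microgrid S L) (hV : G.currentBalance V = 0) :
    G.powerBalance V = G.sourcePower V - G.steadyPower V := by
  have hdet : IsUnit G.Yll.det := (isUnit_iff_isUnit_det _).1 G.Yll_posDef.isUnit
  have hcur : G.Yred *ᵥ src V + (G.Ysl * G.Yll⁻¹) *ᵥ G.loadCurrent (load V)
      = G.Yss *ᵥ src V + G.Ysl *ᵥ load V := by
    rw [G.currentBalance_eq_zero_iff.1 hV, Yred, sub_mulVec, mulVec_add, mulVec_mulVec,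
      mulVec_mulVec, nonsing_inv_mul_cancel_right _ _ hdet]
    abel
  rw [powerBalance, sourcePower, ← mul_add, hcur]

lemma sourcePower_eq_steadyPower (G : Microgrid S L) (hV : V ∈ G.equilibria) :
    G.sourcePower V = G.steadyPower V := by
  rw [← sub_eq_zero, ← G.powerBalance_eq hV.2.1, hV.2.2]

lemma exists_sourcePower_eq_smul (G : Microgrid S L) (hV : V ∈ G.equilibria) :
    ∃ κ : ℝ, 0 ≤ κ ∧ G.sourcePower V = κ • G.C := by
  refine ⟨-((∑ j, G.loadCurrent (load V) j) / ∑ j, (src V j)⁻¹ * G.C j), ?_, ?_⟩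
  · exact neg_nonneg.2 <| div_nonpos_of_nonpos_of_nonneg
      (Finset.sum_nonpos fun j _ => G.loadCurrent_nonpos (fun j => hV.1 _) j)
      (Finset.sum_nonneg fun j _ => mul_nonneg (inv_nonneg.2 (hV.1 _).le) (G.C_pos j).le)
  · funext i
    rw [G.sourcePower_eq_steadyPower hV, steadyPower, Pi.smul_apply, smul_eq_mul, neg_mul, mul_comm]

/-- Kirchhoff's law `𝟙ᵀ B Γ Bᵀ = 0` determines the proportionality factor. -/
lemma steadyPower_eq_smul (G : Microgrid S L) (hpos : V ∈ posOrthant (S ⊕ L))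
    (hcur : G.currentBalance V = 0) {κ : ℝ} (hκ : G.sourcePower V = κ • G.C) :
    G.steadyPower V = κ • G.C := by
  obtain ⟨s⟩ := G.comm_connected.nonempty
  have hsrc : ∀ i, 0 < src V i := fun i => hpos _
  have hden : 0 < ∑ i, (src V i)⁻¹ * G.C i :=
    Finset.sum_pos (fun i _ => mul_pos (inv_pos.2 (hsrc i)) (G.C_pos i)) ⟨s, Finset.mem_univ s⟩
  have hinj : ∀ i, (G.Yss *ᵥ src V + G.Ysl *ᵥ load V) i = κ * ((src V i)⁻¹ * G.C i) := fun i => by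
    have := congrFun hκ i
    rw [sourcePower, Pi.mul_apply, Pi.smul_apply, smul_eq_mul] at this
    rw [mul_left_comm, ← this, inv_mul_cancel_left₀ (hsrc i).ne']
  have hsum := G.sum_Y_mulVec V
  simp only [Y_mulVec, ← G.currentBalance_eq_zero_iff.1 hcur, Fintype.sum_sum_type, Sum.elim_inl,
    Sum.elim_inr, hinj, ← Finset.mul_sum] at hsum
  have hκ' : (∑ j, G.loadCurrent (load V) j) / ∑ i, (src V i)⁻¹ * G.C i = -κ := by
    rw [div_eq_iff hden.ne']
    linarith
  funext i
  rw [steadyPower, hκ', Pi.smul_apply, smul_eq_mul]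
  ring

lemma mem_equilibria_of_sourcePower_eq_smul (G : Microgrid S L) (hpos : V ∈ posOrthant (S ⊕ L))
    (hcur : G.currentBalance V = 0) {κ : ℝ} (hκ : G.sourcePower V = κ • G.C) :
    V ∈ G.equilibria :=
  ⟨hpos, hcur, by rw [G.powerBalance_eq hcur, G.steadyPower_eq_smul hpos hcur hκ, hκ, sub_self]⟩

end Equilibria

section Dissipation

variable {S L : Type*} [Fintype S] [DecidableEq S]

lemma Lc_posSemidef (G : Microgrid S L) : G.Lc.PosSemidef := by
  classical
  exact G.comm.posSemidef_lapMatrix ℝ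

lemma sum_Lc_mulVec (G : Microgrid S L) (u : S → ℝ) : ∑ i, (G.Lc *ᵥ u) i = 0 := by
  classical
  have hone : G.Lc *ᵥ (fun _ => 1) = 0 := G.comm.lapMatrix_mulVec_const_eq_zero
  calc ∑ i, (G.Lc *ᵥ u) i = (fun _ => (1 : ℝ)) ⬝ᵥ G.Lc *ᵥ u := by simp [dotProduct]
    _ = (G.Lcᵀ *ᵥ fun _ => 1) ⬝ᵥ u := by rw [dotProduct_mulVec, mulVec_transpose]
    _ = 0 := by rw [show G.Lcᵀ = G.Lc from G.comm.isSymm_lapMatrix ℝ, hone, zero_dotProduct]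

lemma Lc_mulVec_eq_zero_iff (G : Microgrid S L) {u : S → ℝ} :
    G.Lc *ᵥ u = 0 ↔ ∀ i j, u i = u j := by
  classical
  refine G.comm.lapMatrix_mulVec_eq_zero_iff_forall_reachable.trans ?_
  exact forall₂_congr fun i j => imp_iff_right (G.comm_connected.preconnected i j)

variable [Fintype L] [DecidableEq L]

/-- The source injections `C_s⁻¹ P_s(V)` relative to the controller parameters, whose consensus the
controller enforces. -/
def normalizedPower (G : Microgrid S L) (V : S ⊕ L → ℝ) : S → ℝ :=
  fun i => (G.C i)⁻¹ * G.sourcePower V i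

/-- The rate at which the Bregman function decreases along solutions of the closed loop. -/
def dissipation (G : Microgrid S L) (V : S ⊕ L → ℝ) : ℝ :=
  G.normalizedPower V ⬝ᵥ G.Lc *ᵥ G.normalizedPower V

/-- The right-hand side of the closed-loop differential equation, solved for `V̇_s`. -/
def vectorField (G : Microgrid S L) (V : S ⊕ L → ℝ) : S → ℝ :=
  fun i => -((G.C i)⁻¹ * (src V i * (G.Lc *ᵥ G.normalizedPower V) i))

lemma dissipation_nonneg (G : Microgrid S L) (V : S ⊕ L → ℝ) : 0 ≤ G.dissipation V :=
  G.Lc_posSemidef.dotProduct_mulVec_nonneg _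

lemma mem_equilibria_of_dissipation_eq_zero (G : Microgrid S L) {V : S ⊕ L → ℝ}
    (hpos : V ∈ posOrthant (S ⊕ L)) (hcur : G.currentBalance V = 0)
    (hV : G.dissipation V = 0) : V ∈ G.equilibria := by
  obtain ⟨s⟩ := G.comm_connected.nonempty
  have hconst : ∀ i j, G.normalizedPower V i = G.normalizedPower V j :=
    G.Lc_mulVec_eq_zero_iff.1 ((G.Lc_posSemidef.dotProduct_mulVec_zero_iff _).1 hV)
  refine G.mem_equilibria_of_sourcePower_eq_smul hpos hcur (κ := G.normalizedPower V s) ?_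
  funext i
  rw [hconst s i, normalizedPower, Pi.smul_apply, smul_eq_mul, mul_right_comm,
    inv_mul_cancel₀ (G.C_pos i).ne', one_mul]

lemma eq_vectorField_iff (G : Microgrid S L) (V : S ⊕ L → ℝ) (dVs : S → ℝ) :
    diagonal G.C *ᵥ dVs =
      -((diagonal (src V) * G.Lc * diagonal (fun i => (G.C i)⁻¹)) *ᵥ G.sourcePower V) ↔
    dVs = G.vectorField V := by
  have hu : diagonal (fun i => (G.C i)⁻¹) *ᵥ G.sourcePower V = G.normalizedPower V :=
    funext fun i => mulVec_diagonal _ _ _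
  rw [← mulVec_mulVec, ← mulVec_mulVec, hu, funext_iff, funext_iff]
  refine forall_congr' fun i => ?_
  rw [mulVec_diagonal, Pi.neg_apply, mulVec_diagonal, vectorField,
    ← mul_neg (G.C i)⁻¹, eq_inv_mul_iff_mul_eq₀ (G.C_pos i).ne']

end Dissipation

section Energy

variable {S L : Type*} [Fintype S] [Fintype L] [DecidableEq S] [DecidableEq L]

/-- The matrix of the quadratic part of the energy function. -/
def energyMatrix (G : Microgrid S L) : Matrix (S ⊕ L) (S ⊕ L) ℝ :=
  G.Y + fromBlocks 0 0 0 (diagonal G.Ystar)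

/-- The coefficients `col(P̄_s, P_l^*)` of the logarithms in the energy function. -/
def logCoeff (G : Microgrid S L) (Vbar : S ⊕ L → ℝ) : S ⊕ L → ℝ :=
  Sum.elim (G.sourcePower Vbar) G.Pstar

/-- The gradient of the energy function associated with `V̄`. -/
def energyGradient (G : Microgrid S L) (Vbar V : S ⊕ L → ℝ) : S ⊕ L → ℝ :=
  fun i => (G.energyMatrix *ᵥ V) i - (V i)⁻¹ * G.logCoeff Vbar i

/-- The Hessian matrix of the energy function associated with `V̄`. -/
def hessian (G : Microgrid S L) (Vbar V : S ⊕ L → ℝ) : Matrix (S ⊕ L) (S ⊕ L) ℝ :=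
  G.energyMatrix + diagonal fun i => (V i ^ 2)⁻¹ * G.logCoeff Vbar i

variable {Vbar V : S ⊕ L → ℝ}

lemma energyMatrix_isSymm (G : Microgrid S L) : G.energyMatrix.IsSymm :=
  G.Y_isSymm.add ((isSymm_zero.fromBlocks transpose_zero (isSymm_diagonal _)))

lemma energyMatrix_mulVec (G : Microgrid S L) (V : S ⊕ L → ℝ) :
    G.energyMatrix *ᵥ V = Sum.elim (G.Yss *ᵥ src V + G.Ysl *ᵥ load V)
      (G.Yls *ᵥ src V + G.Yll *ᵥ load V + diagonal G.Ystar *ᵥ load V) := by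
  rw [energyMatrix, add_mulVec, Y_mulVec, fromBlocks_mulVec]
  ext (i | j)
  · simp
  · simp only [zero_mulVec, zero_add, Pi.add_apply, Sum.elim_inr]
    rfl

lemma energyGradient_inl (G : Microgrid S L) {i : S} (hV : src V i ≠ 0) :
    G.energyGradient Vbar V (Sum.inl i) =
      (src V i)⁻¹ * (G.sourcePower V i - G.sourcePower Vbar i) := by
  have hcurrent : (src V i)⁻¹ * G.sourcePower V i = (G.energyMatrix *ᵥ V) (Sum.inl i) := by
    rw [sourcePower, Pi.mul_apply, inv_mul_cancel_left₀ hV, energyMatrix_mulVec, Sum.elim_inl]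
  rw [mul_sub, hcurrent]
  rfl

lemma energyGradient_inr (G : Microgrid S L) (Vbar V : S ⊕ L → ℝ) (j : L) :
    G.energyGradient Vbar V (Sum.inr j) = G.Istar j - G.currentBalance V j := by
  simp only [energyGradient, energyMatrix_mulVec, logCoeff, Sum.elim_inr, currentBalance,
    loadCurrent, Pi.add_apply, Pi.sub_apply, mulVec_diagonal, load]
  ring

lemma energy_eq (G : Microgrid S L) (Vbar V : S ⊕ L → ℝ) :
    G.energy Vbar V =
      (1 / 2) * (V ⬝ᵥ G.energyMatrix *ᵥ V) - ∑ i, G.logCoeff Vbar i * Real.log (V i) := by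
  simp only [energy, energyMatrix, Fintype.sum_sum_type, logCoeff, Sum.elim_inl, Sum.elim_inr, src,
    load, sub_sub]

lemma hasFDerivAt_energy (G : Microgrid S L) (Vbar : S ⊕ L → ℝ) (hV : ∀ i, V i ≠ 0) :
    HasFDerivAt (G.energy Vbar) (dotProductCLM (G.energyGradient Vbar V)) V := by
  have hlog := HasFDerivAt.fun_sum (u := Finset.univ) fun i _ =>
    ((hasFDerivAt_apply i V).log (hV i)).const_mul (G.logCoeff Vbar i)
  have h := (hasFDerivAt_dotProduct_mulVec_self G.energyMatrix_isSymm V).sub hlog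
  refine (h.congr_of_eventuallyEq (Eventually.of_forall (G.energy_eq Vbar))).congr_fderiv ?_
  ext1 d
  simp [dotProductCLM_apply, dotProduct, energyGradient, sub_mul, mul_assoc, mul_left_comm]

lemma hasFDerivAt_energyGradient (G : Microgrid S L) (Vbar : S ⊕ L → ℝ) (hV : ∀ i, V i ≠ 0) :
    HasFDerivAt (G.energyGradient Vbar) (G.hessian Vbar V).mulVecLin.toContinuousLinearMap V := by
  refine hasFDerivAt_pi'.2 fun i => ?_
  have hlin := hasFDerivAt_pi'.1 (G.energyMatrix.mulVecLin.toContinuousLinearMap.hasFDerivAt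
    (x := V)) i
  have hinv := ((hasDerivAt_inv (hV i)).comp_hasFDerivAt V
    (ContinuousLinearMap.proj (R := ℝ) (φ := fun _ : S ⊕ L => ℝ) i).hasFDerivAt).mul_const
      (G.logCoeff Vbar i)
  refine (hlin.sub hinv).congr_fderiv ?_
  ext1 d
  simp [hessian, mulVec_diagonal]
  ring

theorem hessian_self_posDef [Nonempty L] (G : Microgrid S L) (hVbar : Vbar ∈ G.equilibria)
    (hcond : G.MainCondition Vbar) : (G.hessian Vbar Vbar).PosDef := by
  obtain ⟨κ, hκ₀, hκ⟩ := G.exists_sourcePower_eq_smul hVbar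
  set A := G.Yss + diagonal fun i => (src Vbar i ^ 2)⁻¹ * G.sourcePower Vbar i with hA
  set D := G.Yll + diagonal G.Ystar + diagonal fun i => (load Vbar i ^ 2)⁻¹ * G.Pstar i with hD
  have hApos : A.PosDef := G.Yss_posDef.add_posSemidef <| PosSemidef.diagonal fun i => by
    have := G.C_pos i
    simp only [Pi.zero_apply, hκ, Pi.smul_apply, smul_eq_mul]
    positivity
  have hSchur : (D - G.Yslᴴ * A⁻¹ * G.Ysl).PosDef := by
    rw [Ysl_conjTranspose]
    exact hcond
  convert posDef_fromBlocks_of_schurComplement hApos hSchur using 1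
  rw [hessian, energyMatrix, Y_eq_fromBlocks, Ysl_conjTranspose, hA, hD]
  ext (i | i) (j | j) <;> simp [diagonal_apply, logCoeff, src, load]

lemma bregman_self (G : Microgrid S L) (Vbar : S ⊕ L → ℝ) : G.bregman Vbar Vbar = 0 := by
  simp [bregman]

lemma hasFDerivAt_bregman (G : Microgrid S L) (hVbar : ∀ i, Vbar i ≠ 0) (hV : ∀ i, V i ≠ 0) :
    HasFDerivAt (G.bregman Vbar)
      (dotProductCLM (G.energyGradient Vbar V - G.energyGradient Vbar Vbar)) V := by
  rw [map_sub, ← (G.hasFDerivAt_energy Vbar hVbar).fderiv]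
  exact ((G.hasFDerivAt_energy Vbar hV).sub_const _).sub
    ((ContinuousLinearMap.hasFDerivAt _).comp V ((hasFDerivAt_id V).sub_const Vbar))

theorem eventually_bregman_pos [Nonempty L] (G : Microgrid S L) (hVbar : Vbar ∈ G.equilibria)
    (hcond : G.MainCondition Vbar) : ∀ᶠ V in 𝓝[≠] Vbar, 0 < G.bregman Vbar V := by
  have hne := ne_zero_of_mem_posOrthant hVbar.1
  rw [← G.bregman_self Vbar]
  refine eventually_lt_of_isCoercive
    (φ' := fun V => dotProductCLM (G.energyGradient Vbar V - G.energyGradient Vbar Vbar))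
    ?_ (dotProductCLM.hasFDerivAt.comp Vbar
      ((G.hasFDerivAt_energyGradient Vbar hne).sub_const (G.energyGradient Vbar Vbar)))
    (by simp) (isCoercive_of_forall_pos fun d hd => ?_)
  · filter_upwards [posOrthant_mem_nhds hVbar.1] with V hV
    exact G.hasFDerivAt_bregman hne (ne_zero_of_mem_posOrthant hV)
  · rw [ContinuousLinearMap.comp_apply, dotProductCLM_apply, dotProduct_comm]
    exact (G.hessian_self_posDef hVbar hcond).dotProduct_mulVec_pos hd

theorem exists_isCompact_sublevel [Nonempty L] (G : Microgrid S L) (hVbar : Vbar ∈ G.equilibria)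
    (hcond : G.MainCondition Vbar) {U : Set (S ⊕ L → ℝ)} (hU : U ∈ 𝓝 Vbar) :
    ∃ c > 0, IsCompact (G.sublevel Vbar c) ∧ G.sublevel Vbar c ⊆ U ∧
      G.sublevel Vbar c ∈ 𝓝 Vbar := by
  have hpos := posOrthant_mem_nhds hVbar.1
  have hcont : ∀ᶠ V in 𝓝 Vbar, ContinuousAt (G.bregman Vbar) V := by
    filter_upwards [hpos] with V hV
    exact (G.hasFDerivAt_bregman (ne_zero_of_mem_posOrthant hVbar.1)
      (ne_zero_of_mem_posOrthant hV)).continuousAt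
  have hmin := G.eventually_bregman_pos hVbar hcond
  rw [← G.bregman_self Vbar] at hmin ⊢
  exact exists_isCompact_connectedComponentIn_sublevel hcont hmin hpos hU

end Energy

section LocalReduction

variable {S L : Type*} [Fintype S] [Fintype L] [DecidableEq S] [DecidableEq L]

/-- A reduction of the closed loop near `V̄` to an ordinary differential equation for the source
voltages: on the neighbourhood `dom` the load equations determine the load voltages as `loadMap` of
the source voltages, which then evolve according to `field`. Both functions are defined globally, so
that the differential equation has global solutions. -/
structure LocalReduction (G : Microgrid S L) (Vbar : S ⊕ L → ℝ) where
  dom : Set (S ⊕ L → ℝ)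
  isOpen_dom : IsOpen dom
  mem_dom : Vbar ∈ dom
  dom_subset : dom ⊆ posOrthant (S ⊕ L)
  loadMap : (S → ℝ) → L → ℝ
  continuous_loadMap : Continuous loadMap
  differentiableAt_loadMap : ∀ V ∈ dom, DifferentiableAt ℝ loadMap (src V)
  currentBalance_eq_zero_iff : ∀ V ∈ dom, G.currentBalance V = 0 ↔ loadMap (src V) = load V
  field : (S → ℝ) → S → ℝ
  exists_lipschitzWith_field : ∃ K, LipschitzWith K field
  exists_norm_field_le : ∃ B : NNReal, ∀ y, ‖field y‖ ≤ B
  field_src : ∀ V ∈ dom, G.currentBalance V = 0 → field (src V) = G.vectorField V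

lemma contDiff_sourcePower (G : Microgrid S L) : ContDiff ℝ 1 G.sourcePower := by
  refine contDiff_pi.2 fun i => ?_
  simp only [sourcePower, Pi.mul_apply, Pi.add_apply, mulVec, dotProduct, src, load]
  fun_prop

lemma contDiff_normalizedPower (G : Microgrid S L) : ContDiff ℝ 1 G.normalizedPower :=
  contDiff_pi.2 fun i => contDiff_const.mul ((contDiff_pi.1 G.contDiff_sourcePower) i)

lemma continuous_dissipation (G : Microgrid S L) : Continuous G.dissipation :=
  have hcont := G.contDiff_normalizedPower.continuous
  hcont.dotProduct (continuous_const.matrix_mulVec hcont)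

lemma contDiff_vectorField (G : Microgrid S L) : ContDiff ℝ 1 G.vectorField := by
  have := G.contDiff_normalizedPower
  refine contDiff_pi.2 fun i => ?_
  simp only [vectorField, mulVec, dotProduct, src]
  fun_prop

variable {Vbar V : S ⊕ L → ℝ}

lemma contDiffAt_currentBalance (G : Microgrid S L) (hV : ∀ i, V i ≠ 0) :
    ContDiffAt ℝ 1 G.currentBalance V := by
  refine contDiffAt_pi.2 fun j => ?_
  have hinv : ContDiffAt ℝ 1 (fun W : S ⊕ L → ℝ => (W (Sum.inr j))⁻¹) V :=
    ContDiffAt.inv (by fun_prop) (hV _)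
  simp only [currentBalance, loadCurrent, Pi.add_apply, Pi.sub_apply, mulVec_diagonal]
  simp only [mulVec, dotProduct, src, load]
  fun_prop

lemma hasFDerivAt_currentBalance (G : Microgrid S L) (Vbar : S ⊕ L → ℝ) (hV : ∀ i, V i ≠ 0) :
    HasFDerivAt G.currentBalance
      (-ContinuousLinearMap.pi fun j => dotProductCLM (G.hessian Vbar V (Sum.inr j))) V := by
  refine hasFDerivAt_pi'.2 fun j => ?_
  have h := (hasFDerivAt_pi'.1 (G.hasFDerivAt_energyGradient Vbar hV) (Sum.inr j)).const_sub
    (G.Istar j)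
  refine (h.congr_of_eventuallyEq (Eventually.of_forall fun W => ?_)).congr_fderiv rfl
  simp only [energyGradient_inr, sub_sub_cancel]

lemma exists_implicit_loadMap [Nonempty L] (G : Microgrid S L) (hVbar : Vbar ∈ G.equilibria)
    (hcond : G.MainCondition Vbar) :
    ∃ η : (S → ℝ) → L → ℝ, ContDiffAt ℝ 1 η (src Vbar) ∧
      ∀ᶠ V in 𝓝 Vbar, G.currentBalance V = 0 ↔ η (src V) = load V := by
  have hne := ne_zero_of_mem_posOrthant hVbar.1
  rw [← hVbar.2.1]
  refine exists_contDiffAt_eventually_eq_iff_of_injective (G.contDiffAt_currentBalance hne)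
    (G.hasFDerivAt_currentBalance Vbar hne) fun v hv => ?_
  by_contra hv₀
  have hpos := (G.hessian_self_posDef hVbar hcond).dotProduct_mulVec_pos
    (x := Sum.elim (0 : S → ℝ) v) fun h => hv₀ (congrArg load h)
  have hload : ∀ j, (G.hessian Vbar Vbar *ᵥ Sum.elim 0 v) (Sum.inr j) = 0 := fun j =>
    neg_eq_zero.1 (congrFun hv j)
  simp [dotProduct, Fintype.sum_sum_type, hload] at hpos

theorem nonempty_localReduction [Nonempty L] (G : Microgrid S L) (hVbar : Vbar ∈ G.equilibria)
    (hcond : G.MainCondition Vbar) : Nonempty (G.LocalReduction Vbar) := by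
  obtain ⟨η₀, hη₀, hη₀_iff⟩ := G.exists_implicit_loadMap hVbar hcond
  obtain ⟨η, K, -, hη, -, hη_eq⟩ := exists_bounded_lipschitzWith_eventuallyEq hη₀
  have hη_diff : ContDiffAt ℝ 1 η (src Vbar) := hη₀.congr_of_eventuallyEq hη_eq.symm
  obtain ⟨F, K', B, hF, hFB, hF_eq⟩ := exists_bounded_lipschitzWith_eventuallyEq
    (f := fun y => G.vectorField (Sum.elim y (η y))) (x₀ := src Vbar)
    (G.contDiff_vectorField.contDiffAt.comp _ <|
      contDiffAt_pi.2 (Sum.rec (contDiffAt_pi.1 contDiffAt_id) (contDiffAt_pi.1 hη_diff)))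
  have hsrc : Tendsto src (𝓝 Vbar) (𝓝 (src Vbar)) := continuous_src.tendsto Vbar
  have hpos : ∀ᶠ V in 𝓝 Vbar, V ∈ posOrthant (S ⊕ L) := posOrthant_mem_nhds hVbar.1
  obtain ⟨U, hU, hU_open, hVbar_mem⟩ := eventually_nhds_iff.1 <| hpos.and <| hη₀_iff.and <|
    hsrc.eventually <| hη_eq.and <| hF_eq.and <| hη_diff.eventually (by simp)
  exact ⟨{
    dom := U
    isOpen_dom := hU_open
    mem_dom := hVbar_mem
    dom_subset := fun V hV => (hU V hV).1
    loadMap := η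
    continuous_loadMap := hη.continuous
    differentiableAt_loadMap := fun V hV => (hU V hV).2.2.2.2.differentiableAt one_ne_zero
    currentBalance_eq_zero_iff := fun V hV => by
      obtain ⟨-, hiff, hη_src, -⟩ := hU V hV
      rw [hiff, hη_src]
    field := F
    exists_lipschitzWith_field := ⟨K', hF⟩
    exists_norm_field_le := ⟨B, hFB⟩
    field_src := fun V hV hbal => by
      obtain ⟨-, hiff, hη_src, hF_src, -⟩ := hU V hV
      have hload : η (src V) = load V := hη_src ▸ hiff.1 hbal
      beta_reduce at hF_src
      rw [← hF_src, hload]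
      exact congrArg G.vectorField (Sum.elim_comp_inl_inr V) }⟩

end LocalReduction

section Solutions

variable {S L : Type*} [Fintype S] [Fintype L] [DecidableEq S] [DecidableEq L]
  {G : Microgrid S L} {J J' : Set ℝ} {V : ℝ → S ⊕ L → ℝ}

lemma isSolutionOn_iff : G.IsSolutionOn J V ↔ ContinuousOn V J ∧
    (∀ t ∈ J, HasDerivWithinAt (fun τ => src (V τ)) (G.vectorField (V t)) J t) ∧
      ∀ t ∈ J, G.currentBalance (V t) = 0 := by
  constructor
  · rintro ⟨hcont, hsource, halg⟩
    refine ⟨hcont, fun t ht => ?_, fun t ht =>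
      G.currentBalance_eq_zero_iff.2 (neg_injective (halg t ht))⟩
    obtain ⟨dVs, hderiv, heq⟩ := hsource t ht
    exact (G.eq_vectorField_iff (V t) dVs).1 heq ▸ hderiv
  · rintro ⟨hcont, hderiv, hbal⟩
    exact ⟨hcont, fun t ht => ⟨_, hderiv t ht, (G.eq_vectorField_iff _ _).2 rfl⟩,
      fun t ht => congrArg Neg.neg (G.currentBalance_eq_zero_iff.1 (hbal t ht))⟩

namespace IsSolutionOn

lemma hasDerivWithinAt (h : G.IsSolutionOn J V) {t : ℝ} (ht : t ∈ J) :
    HasDerivWithinAt (fun τ => src (V τ)) (G.vectorField (V t)) J t :=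
  (isSolutionOn_iff.1 h).2.1 t ht

lemma currentBalance_eq_zero (h : G.IsSolutionOn J V) {t : ℝ} (ht : t ∈ J) :
    G.currentBalance (V t) = 0 :=
  (isSolutionOn_iff.1 h).2.2 t ht

lemma mono (h : G.IsSolutionOn J V) (hJ : J' ⊆ J) : G.IsSolutionOn J' V :=
  isSolutionOn_iff.2 ⟨h.continuousOn.mono hJ, fun _ ht => (h.hasDerivWithinAt (hJ ht)).mono hJ,
    fun _ ht => h.currentBalance_eq_zero (hJ ht)⟩

end IsSolutionOn

end Solutions

section GeomMean

variable {S L : Type*} [Fintype S]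

lemma geomMean_eq_exp (G : Microgrid S L) {V : S ⊕ L → ℝ} (hV : V ∈ posOrthant (S ⊕ L)) :
    G.geomMean V = Real.exp (∑ i, G.C i * Real.log (src V i)) := by
  rw [geomMean, Real.exp_sum]
  refine Finset.prod_congr rfl fun i _ => ?_
  rw [Real.rpow_def_of_pos (show 0 < src V i from hV _), mul_comm]

lemma continuousOn_geomMean (G : Microgrid S L) :
    ContinuousOn G.geomMean (posOrthant (S ⊕ L)) :=
  continuousOn_finsetProd _ fun i _ =>
    (continuous_apply (Sum.inl i)).continuousOn.rpow_const fun _ hV => Or.inl (hV (Sum.inl i)).ne'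

variable [Fintype L] [DecidableEq S] [DecidableEq L] {G : Microgrid S L} {J : Set ℝ}
  {V : ℝ → S ⊕ L → ℝ}

theorem IsSolutionOn.geomMean_eq (h : G.IsSolutionOn J V) (hJ : Convex ℝ J)
    (hpos : MapsTo V J (posOrthant (S ⊕ L))) {s t : ℝ} (hs : s ∈ J) (ht : t ∈ J) :
    G.geomMean (V t) = G.geomMean (V s) := by
  have hderiv : ∀ τ ∈ J,
      HasDerivWithinAt (fun τ => ∑ i, G.C i * Real.log (src (V τ) i)) 0 J τ := by
    intro τ hτ
    have hne : ∀ i, src (V τ) i ≠ 0 := fun i => (hpos hτ (Sum.inl i)).ne'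
    have hsum := HasDerivWithinAt.fun_sum (u := Finset.univ) fun i _ =>
      ((hasDerivWithinAt_pi.1 (h.hasDerivWithinAt hτ) i).log (hne i)).const_mul (G.C i)
    refine hsum.congr_deriv ?_
    rw [← neg_zero, ← G.sum_Lc_mulVec (G.normalizedPower (V τ)), ← Finset.sum_neg_distrib]
    refine Finset.sum_congr rfl fun i _ => ?_
    have hC := (G.C_pos i).ne'
    have hi := hne i
    rw [vectorField]
    field_simp
  rw [G.geomMean_eq_exp (hpos ht), G.geomMean_eq_exp (hpos hs)]
  refine congrArg Real.exp (sub_eq_zero.1 (norm_le_zero_iff.1 ?_))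
  simpa using hJ.norm_image_sub_le_of_norm_hasDerivWithin_le (C := 0) hderiv (by simp) hs ht

lemma isCompact_meanSet (G : Microgrid S L) {K : Set (S ⊕ L → ℝ)} (hK : IsCompact K)
    (hpos : K ⊆ posOrthant (S ⊕ L)) (V₀ : S ⊕ L → ℝ) : IsCompact (G.meanSet K V₀) := by
  have hcont : ContinuousOn (fun V => (G.currentBalance V, G.geomMean V)) K :=
    ContinuousOn.prodMk (fun V hV => (G.contDiffAt_currentBalance
      (ne_zero_of_mem_posOrthant (hpos hV))).continuousAt.continuousWithinAt)
      (G.continuousOn_geomMean.mono hpos)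
  have hclosed : IsClosed (G.meanSet K V₀) := by
    convert hcont.preimage_isClosed_of_isClosed hK.isClosed
      (isClosed_singleton (x := (0, G.geomMean V₀))) using 1
    ext V
    simp only [meanSet, mem_ofPred_eq, mem_inter_iff, mem_preimage, mem_singleton_iff,
      Prod.mk.injEq]
  exact hK.of_isClosed_subset hclosed fun V hV => hV.1

end GeomMean

section Reduction

variable {S L : Type*} [Fintype S] [Fintype L] [DecidableEq S] [DecidableEq L]
  {G : Microgrid S L} {Vbar : S ⊕ L → ℝ}

-- Consensus at `V̄` makes `P̄_s` a multiple of `C`, which `L_c` cannot see; the loads contribute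
-- nothing since the load part of the gradient difference is a difference of current balances.
lemma energyGradient_sub_dotProduct_vectorField (hVbar : Vbar ∈ G.equilibria) {V : S ⊕ L → ℝ}
    (hV : V ∈ posOrthant (S ⊕ L)) (hbal : G.currentBalance V = 0) (z : L → ℝ) :
    (G.energyGradient Vbar V - G.energyGradient Vbar Vbar) ⬝ᵥ Sum.elim (G.vectorField V) z =
      -G.dissipation V := by
  obtain ⟨κ, -, hκ⟩ := G.exists_sourcePower_eq_smul hVbar
  have hsource : ∀ i, (G.energyGradient Vbar V (Sum.inl i) - G.energyGradient Vbar Vbar (Sum.inl i))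
      * G.vectorField V i = κ * (G.Lc *ᵥ G.normalizedPower V) i
        - G.normalizedPower V i * (G.Lc *ᵥ G.normalizedPower V) i := by
    intro i
    have hC := (G.C_pos i).ne'
    have hi : src V i ≠ 0 := (hV _).ne'
    rw [energyGradient_inl G hi, energyGradient_inl G (hVbar.1 (Sum.inl i)).ne', sub_self, mul_zero,
      sub_zero, hκ, Pi.smul_apply, smul_eq_mul, vectorField]
    generalize (G.Lc *ᵥ G.normalizedPower V) i = z
    rw [normalizedPower]
    field_simp
    ring
  simp only [dotProduct, Fintype.sum_sum_type, Pi.sub_apply, Sum.elim_inl, Sum.elim_inr, hsource,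
    energyGradient_inr, hbal, hVbar.2.1, sub_self, zero_mul, Finset.sum_const_zero, add_zero]
  rw [Finset.sum_sub_distrib, ← Finset.mul_sum, sum_Lc_mulVec, mul_zero, zero_sub]
  rfl

namespace LocalReduction

variable (R : G.LocalReduction Vbar) {J : Set ℝ} {V W : ℝ → S ⊕ L → ℝ} {a b c : ℝ}

/-- The voltage vector determined by the source voltages `y` and the load equations. -/
def lift (y : S → ℝ) : S ⊕ L → ℝ := Sum.elim y (R.loadMap y)

lemma lift_src {V : S ⊕ L → ℝ} (hV : V ∈ R.dom) (hbal : G.currentBalance V = 0) :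
    R.lift (src V) = V := by
  rw [lift, (R.currentBalance_eq_zero_iff V hV).1 hbal]
  exact Sum.elim_comp_inl_inr V

lemma continuous_lift : Continuous R.lift :=
  continuous_pi <| Sum.rec continuous_apply (continuous_pi_iff.1 R.continuous_loadMap)

theorem isSolutionOn_lift {y : ℝ → S → ℝ} (hy : ∀ t, HasDerivAt y (R.field (y t)) t)
    (hJ : MapsTo (fun t => R.lift (y t)) J R.dom) :
    G.IsSolutionOn J fun t => R.lift (y t) := by
  have hcont : Continuous y := continuous_iff_continuousAt.2 fun t => (hy t).continuousAt
  have hbal : ∀ t ∈ J, G.currentBalance (R.lift (y t)) = 0 := fun t ht =>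
    (R.currentBalance_eq_zero_iff _ (hJ ht)).2 rfl
  refine isSolutionOn_iff.2 ⟨(R.continuous_lift.comp hcont).continuousOn, fun t ht => ?_, hbal⟩
  rw [← R.field_src _ (hJ ht) (hbal t ht)]
  exact (hy t).hasDerivWithinAt

section Solution

variable {R} (hV : G.IsSolutionOn J V) (hdom : MapsTo V J R.dom)
include hV hdom

lemma hasDerivWithinAt_src {t : ℝ} (ht : t ∈ J) :
    HasDerivWithinAt (fun τ => src (V τ)) (R.field (src (V t))) J t := by
  rw [R.field_src _ (hdom ht) (hV.currentBalance_eq_zero ht)]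
  exact hV.hasDerivWithinAt ht

lemma eqOn_lift_src : EqOn (fun t => R.lift (src (V t))) V J := fun _ ht =>
  R.lift_src (hdom ht) (hV.currentBalance_eq_zero ht)

theorem hasDerivWithinAt_bregman (hVbar : Vbar ∈ G.equilibria) {t : ℝ} (ht : t ∈ J) :
    HasDerivWithinAt (fun τ => G.bregman Vbar (V τ)) (-G.dissipation (V t)) J t := by
  have hpos := R.dom_subset (hdom ht)
  have hbal := hV.currentBalance_eq_zero ht
  obtain ⟨z, hload⟩ : ∃ z, HasDerivWithinAt (fun τ => R.loadMap (src (V τ))) z J t :=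
    ⟨_, (R.differentiableAt_loadMap _ (hdom ht)).hasFDerivAt.comp_hasDerivWithinAt t
      (hV.hasDerivWithinAt ht)⟩
  have hlift : HasDerivWithinAt (fun τ => R.lift (src (V τ))) (Sum.elim (G.vectorField (V t)) z)
      J t :=
    hasDerivWithinAt_pi.2 <| Sum.rec (hasDerivWithinAt_pi.1 (hV.hasDerivWithinAt ht))
      (hasDerivWithinAt_pi.1 hload)
  have hderiv := hlift.congr_of_mem (fun τ hτ => (eqOn_lift_src hV hdom hτ).symm) ht
  rw [← energyGradient_sub_dotProduct_vectorField hVbar hpos hbal z]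
  exact (G.hasFDerivAt_bregman (ne_zero_of_mem_posOrthant hVbar.1)
    (ne_zero_of_mem_posOrthant hpos)).comp_hasDerivWithinAt t hderiv

theorem antitoneOn_bregman (hVbar : Vbar ∈ G.equilibria) (hJ : Convex ℝ J) :
    AntitoneOn (G.bregman Vbar ∘ V) J :=
  antitoneOn_of_hasDerivWithinAt_nonpos hJ
    (fun _ ht => (hasDerivWithinAt_bregman hV hdom hVbar ht).continuousWithinAt)
    (fun _ ht => (hasDerivWithinAt_bregman hV hdom hVbar (interior_subset ht)).mono interior_subset)
    fun _ _ => neg_nonpos.2 (G.dissipation_nonneg _)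

end Solution

theorem eqOn_of_isSolutionOn (hV : G.IsSolutionOn (Icc a b) V) (hVdom : MapsTo V (Icc a b) R.dom)
    (hW : G.IsSolutionOn (Icc a b) W) (hWdom : MapsTo W (Icc a b) R.dom) (h : V a = W a) :
    EqOn V W (Icc a b) := by
  obtain ⟨K, hK⟩ := R.exists_lipschitzWith_field
  have hsrc : EqOn (fun t => src (V t)) (fun t => src (W t)) (Icc a b) :=
    ODE_solution_unique (v := fun _ => R.field) (fun _ => hK)
      (fun t ht => (hasDerivWithinAt_src hV hVdom ht).continuousWithinAt)
      (fun t ht => (hasDerivWithinAt_src hV hVdom (Ico_subset_Icc_self ht)).mono_of_mem_nhdsWithin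
        (Icc_mem_nhdsGE_of_mem ht))
      (fun t ht => (hasDerivWithinAt_src hW hWdom ht).continuousWithinAt)
      (fun t ht => (hasDerivWithinAt_src hW hWdom (Ico_subset_Icc_self ht)).mono_of_mem_nhdsWithin
        (Icc_mem_nhdsGE_of_mem ht))
      (congrArg src h)
  intro t ht
  calc V t = R.lift (src (V t)) := (eqOn_lift_src hV hVdom ht).symm
    _ = R.lift (src (W t)) := congrArg R.lift (hsrc ht)
    _ = W t := eqOn_lift_src hW hWdom ht

section Sublevel

variable (hVbar : Vbar ∈ G.equilibria) (hcomp : IsCompact (G.sublevel Vbar c))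
  (hsub : G.sublevel Vbar c ⊆ R.dom)
include hVbar hcomp hsub

theorem mapsTo_sublevel (hcont : ContinuousOn V (Icc a b)) (ha : V a ∈ G.sublevel Vbar c)
    (hV : ∀ J ⊆ Icc a b, MapsTo V J R.dom → G.IsSolutionOn J V) :
    MapsTo V (Icc a b) (G.sublevel Vbar c) :=
  mapsTo_connectedComponentIn_sublevel hcomp.isClosed R.isOpen_dom R.dom_subset hsub hcont ha
    fun _ _ hJ hdom => antitoneOn_bregman (hV _ hJ hdom) hdom hVbar (convex_Icc _ _)

lemma mapsTo_sublevel_of_isSolutionOn (hV : G.IsSolutionOn (Icc a b) V)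
    (ha : V a ∈ G.sublevel Vbar c) : MapsTo V (Icc a b) (G.sublevel Vbar c) :=
  R.mapsTo_sublevel hVbar hcomp hsub hV.continuousOn ha fun _ hJ _ => hV.mono hJ

lemma mapsTo_sublevel_Ici_of_isSolutionOn (hV : G.IsSolutionOn (Ici a) V)
    (ha : V a ∈ G.sublevel Vbar c) : MapsTo V (Ici a) (G.sublevel Vbar c) := fun _ ht =>
  R.mapsTo_sublevel_of_isSolutionOn hVbar hcomp hsub (hV.mono Icc_subset_Ici_self) ha
    (right_mem_Icc.2 ht)

theorem exists_isSolutionOn_Ici {V₀ : S ⊕ L → ℝ} (hV₀ : V₀ ∈ G.sublevel Vbar c)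
    (hbal : G.currentBalance V₀ = 0) :
    ∃ V : ℝ → S ⊕ L → ℝ, V 0 = V₀ ∧ G.IsSolutionOn (Ici 0) V := by
  obtain ⟨K, hK⟩ := R.exists_lipschitzWith_field
  obtain ⟨B, hB⟩ := R.exists_norm_field_le
  obtain ⟨y, hy₀, hy⟩ := exists_forall_hasDerivAt_of_lipschitzWith_of_norm_le hK hB (src V₀)
  have hcont : Continuous y := continuous_iff_continuousAt.2 fun t => (hy t).continuousAt
  have hinit : R.lift (y 0) = V₀ := by rw [hy₀, R.lift_src (hsub hV₀) hbal]
  refine ⟨fun t => R.lift (y t), hinit, R.isSolutionOn_lift hy fun t ht => hsub ?_⟩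
  exact R.mapsTo_sublevel (V := fun t => R.lift (y t)) hVbar hcomp hsub
    (R.continuous_lift.comp hcont).continuousOn (hinit.symm ▸ hV₀)
    (fun J _ => R.isSolutionOn_lift hy) (right_mem_Icc.2 ht)

theorem exists_isSolutionOn_Ici_eqOn {T : ℝ} (hT : 0 < T) (hV : G.IsSolutionOn (Ico 0 T) V)
    (h₀ : V 0 ∈ G.sublevel Vbar c) :
    ∃ W : ℝ → S ⊕ L → ℝ, G.IsSolutionOn (Ici 0) W ∧ EqOn W V (Ico 0 T) := by
  obtain ⟨W, hW₀, hW⟩ := R.exists_isSolutionOn_Ici hVbar hcomp hsub h₀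
    (hV.currentBalance_eq_zero (left_mem_Ico.2 hT))
  refine ⟨W, hW, fun t ht => ?_⟩
  have hVt := hV.mono (Icc_subset_Ico_right ht.2)
  have hWt : G.IsSolutionOn (Icc 0 t) W := hW.mono Icc_subset_Ici_self
  exact R.eqOn_of_isSolutionOn
    hWt ((R.mapsTo_sublevel_of_isSolutionOn hVbar hcomp hsub hWt (hW₀ ▸ h₀)).mono_right hsub)
    hVt ((R.mapsTo_sublevel_of_isSolutionOn hVbar hcomp hsub hVt h₀).mono_right hsub)
    hW₀ (right_mem_Icc.2 ht.1)

end Sublevel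

lemma uniformContinuousOn_dissipation {K : Set (S ⊕ L → ℝ)} (hK : IsCompact K) (hKR : K ⊆ R.dom)
    (hJ : Convex ℝ J) (hV : G.IsSolutionOn J V) (hVK : MapsTo V J K) :
    UniformContinuousOn (fun t => G.dissipation (V t)) J := by
  have hdom := hVK.mono_right hKR
  obtain ⟨B, hB⟩ := R.exists_norm_field_le
  have hsrc : UniformContinuousOn (fun t => src (V t)) J :=
    (hJ.lipschitzOnWith_of_nnnorm_hasDerivWithin_le (fun t ht => hasDerivWithinAt_src hV hdom ht)
      fun t _ => show _ ≤ B from hB (src (V t))).uniformContinuousOn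
  have hdiss : UniformContinuousOn (G.dissipation ∘ R.lift) (src '' K) :=
    (hK.image continuous_src).uniformContinuousOn_of_continuous
      (G.continuous_dissipation.comp R.continuous_lift).continuousOn
  refine (hdiss.comp hsrc fun t ht => mem_image_of_mem src (hVK ht)).congr fun t ht => ?_
  exact congrArg G.dissipation (eqOn_lift_src hV hdom ht)

theorem tendsto_dissipation (hVbar : Vbar ∈ G.equilibria) {K : Set (S ⊕ L → ℝ)} (hK : IsCompact K)
    (hKR : K ⊆ R.dom) (hV : G.IsSolutionOn (Ici a) V) (hVK : MapsTo V (Ici a) K) :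
    Tendsto (fun t => G.dissipation (V t)) atTop (𝓝 0) := by
  have hdom := hVK.mono_right hKR
  have hcont : ContinuousOn (G.bregman Vbar) K := fun W hW =>
    (G.hasFDerivAt_bregman (ne_zero_of_mem_posOrthant hVbar.1)
      (ne_zero_of_mem_posOrthant (R.dom_subset (hKR hW)))).continuousAt.continuousWithinAt
  have hbdd : BddBelow ((G.bregman Vbar ∘ V) '' Ici a) := by
    rw [image_comp]
    exact (hK.bddBelow_image hcont).mono (image_mono hVK.image_subset)
  obtain ⟨l, hl⟩ := exists_tendsto_of_antitoneOn_Ici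
    (antitoneOn_bregman hV hdom hVbar (convex_Ici a)) hbdd
  have hneg : Tendsto (fun t => -G.dissipation (V t)) atTop (𝓝 0) :=
    tendsto_zero_of_tendsto_of_uniformContinuousOn_deriv
      (fun t ht => hasDerivWithinAt_bregman hV hdom hVbar ht)
      (uniformContinuous_neg.comp_uniformContinuousOn
        (R.uniformContinuousOn_dissipation hK hKR (convex_Ici a) hV hVK)) hl
  simpa only [neg_neg, neg_zero] using hneg.neg

theorem tendsto_infEDist (hVbar : Vbar ∈ G.equilibria) {K : Set (S ⊕ L → ℝ)} (hK : IsCompact K)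
    (hKR : K ⊆ R.dom) (hV : G.IsSolutionOn (Ici a) V) (hVK : MapsTo V (Ici a) K) :
    Tendsto (fun t => Metric.infEDist (V t) (G.equilibria ∩ K ∩ G.meanSet K (V a)))
      atTop (𝓝 0) := by
  have hpos := hKR.trans R.dom_subset
  have hmean : ∀ᶠ t in atTop, V t ∈ G.meanSet K (V a) := by
    filter_upwards [eventually_ge_atTop a] with t ht
    exact ⟨hVK ht, hV.currentBalance_eq_zero ht,
      hV.geomMean_eq (convex_Ici a) (hVK.mono_right hpos) self_mem_Ici ht⟩
  refine tendsto_of_tendsto_of_tendsto_of_le_of_le tendsto_const_nhds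
    (tendsto_infEDist_of_tendsto_zero (G.isCompact_meanSet hK hpos (V a))
      G.continuous_dissipation.continuousOn hmean (R.tendsto_dissipation hVbar hK hKR hV hVK))
    (fun _ => zero_le) fun t => Metric.infEDist_anti ?_
  rintro W ⟨hW, hzero⟩
  exact ⟨⟨G.mem_equilibria_of_dissipation_eq_zero (hpos hW.1) hW.2.1 hzero, hW.1⟩, hW⟩

end LocalReduction

end Reduction

end

end Microgrid

theorem theorem1 {S L : Type*} [Fintype S] [Fintype L] [DecidableEq S] [DecidableEq L]
    [Nonempty L] (G : Microgrid S L) (Vbar : S ⊕ L → ℝ)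
    (hVbar : Vbar ∈ G.equilibria) (hcond : G.MainCondition Vbar) :
    ∃ Λ : Set (S ⊕ L → ℝ),
      (∃ c : ℝ, 0 < c ∧ Λ = G.sublevel Vbar c) ∧
      IsCompact Λ ∧ Λ ⊆ Microgrid.posOrthant (S ⊕ L) ∧ Λ ∈ 𝓝 Vbar ∧
      -- existence for all times, from every initial condition compatible with the load equations
      (∀ V0 ∈ Λ, G.currentBalance V0 = 0 →
        ∃ V : ℝ → S ⊕ L → ℝ, V 0 = V0 ∧ G.IsSolutionOn (Ici 0) V) ∧
      -- every solution on a bounded interval that starts in `Λ` extends to all times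
      (∀ (T : ℝ) (V : ℝ → S ⊕ L → ℝ), 0 < T → G.IsSolutionOn (Ico 0 T) V → V 0 ∈ Λ →
        ∃ W : ℝ → S ⊕ L → ℝ, G.IsSolutionOn (Ici 0) W ∧ EqOn W V (Ico 0 T)) ∧
      -- every solution that starts in `Λ` stays there, with positive voltages, preserves the
      -- weighted geometric mean of the source voltages, and converges
      (∀ V : ℝ → S ⊕ L → ℝ, G.IsSolutionOn (Ici 0) V → V 0 ∈ Λ →
        (∀ t, 0 ≤ t → V t ∈ Λ ∧ (∀ i, 0 < V t i) ∧ G.geomMean (V t) = G.geomMean (V 0)) ∧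
        Tendsto (fun t => Metric.infEDist (V t) (G.equilibria ∩ Λ ∩ G.meanSet Λ (V 0)))
          atTop (𝓝 0)) := by
  obtain ⟨R⟩ := G.nonempty_localReduction hVbar hcond
  obtain ⟨c, hc, hcomp, hsub, hnhds⟩ :=
    G.exists_isCompact_sublevel hVbar hcond (R.isOpen_dom.mem_nhds R.mem_dom)
  have hpos := hsub.trans R.dom_subset
  refine ⟨G.sublevel Vbar c, ⟨c, hc, rfl⟩, hcomp, hpos, hnhds,
    fun _ => R.exists_isSolutionOn_Ici hVbar hcomp hsub,
    fun _ _ => R.exists_isSolutionOn_Ici_eqOn hVbar hcomp hsub, fun V hV h₀ => ?_⟩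
  have hmaps := R.mapsTo_sublevel_Ici_of_isSolutionOn hVbar hcomp hsub hV h₀
  exact ⟨fun t ht => ⟨hmaps ht, hpos (hmaps ht),
    hV.geomMean_eq (convex_Ici 0) (hmaps.mono_right hpos) self_mem_Ici ht⟩,
    R.tendsto_infEDist hVbar hcomp hsub hV hmaps⟩
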